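/- For a real number $t>1$ and an integer $J\ge 1$, put the observer at $P_{t,J}=(-tJ^2,0)$ and consider the $N_J=(2J+1)(J+1)$ lattice points $P=(a,m)\in\mathbb Z^2$ with $-J\le a\le J$, $0\le m\le J$, that is, the lattice points of $J\cdot([-1,1]\times[0,1])$. Let $O=(0,0)$, and let $0=\alpha_1\le\alpha_2\le\dots\le\alpha_{N_J}$ be the angles $\angle(P\,P_{t,J}\,O)$ of these points, listed in increasing order with multiplicity. Put $\Delta_{av}=\alpha_{N_J}/N_J$ and, for $\lambda\ge 0$, $$G_{t,J}(\lambda)=\frac1{N_J}\,\#\{\,1\le j<N_J:\ \alpha_{j+1}-\alpha_j\ge\lambda\,\Delta_{av}\,\}.$$ Then for every $t>1$ and every $\lambda\ge0$ the limit $G_t(\lambda)=\lim_{J\to\infty}G_{t,J}(\lambda)$, taken over the integers $J$, exists, and it is given as follows. 1. If $t>2$, then $$G_t(\lambda)=\begin{cases}1-\dfrac{\lambda t}{2}, & 0\le\lambda\le \dfrac2t,\\[4pt] 0, & \lambda\ge\dfrac2t.\end{cases}$$ 2. If $1<t\le2$, then $$G_t(\lambda)=\begin{cases}1+\dfrac{\lambda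 t}{2}+\lambda t\log\dfrac t2-\dfrac{\lambda t^2}{2}, & 0\le\lambda\le1,\\[4pt] 1-\dfrac{\lambda t}{2}+\lambda t\log\dfrac{\lambda t}{2}-\dfrac{\lambda t^2}{2}+t, & 1\le\lambda\le\dfrac2t,\\[4pt] 0, & \lambda\ge\dfrac2t.\end{cases}$$ -/

import Mathlib

open Filter Topology

noncomputable section

namespace MovingObserver

/-- The lattice points `(a, m)` in `J · ([-1, 1] × [0, 1])`, that is, the pairs of integers with
`-J ≤ a ≤ J` and `0 ≤ m ≤ J`. -/
def latticePoints (J : ℕ) : Finset (ℤ × ℤ) :=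
  Finset.Icc (-(J : ℤ)) (J : ℤ) ×ˢ Finset.Icc (0 : ℤ) (J : ℤ)

/-- The lattice point `(a, m)` as a point of the Euclidean plane. -/
def toPlane (p : ℤ × ℤ) : EuclideanSpace ℝ (Fin 2) :=
  !₂[(p.1 : ℝ), (p.2 : ℝ)]

/-- The position `(-t J², 0)` of the observer. -/
def observer (t : ℝ) (J : ℕ) : EuclideanSpace ℝ (Fin 2) :=
  !₂[-(t * (J : ℝ) ^ 2), 0]

/-- The (unoriented) angle at the observer between the lattice point `p` and the origin. -/
def viewAngle (t : ℝ) (J : ℕ) (p : ℤ × ℤ) : ℝ :=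
  EuclideanGeometry.angle (toPlane p) (observer t J) 0

/-- The number `N_J` of lattice points. -/
def numPoints (J : ℕ) : ℕ := (latticePoints J).card

/-- The angles of all lattice points, listed with multiplicity in nondecreasing order. -/
def sortedAngles (t : ℝ) (J : ℕ) : List ℝ :=
  ((latticePoints J).val.map (viewAngle t J)).sort (· ≤ ·)

/-- The `j`-th smallest angle `α_j`, for `1 ≤ j ≤ N_J` (other values of `j` are never used). -/
def orderedAngle (t : ℝ) (J : ℕ) (j : ℕ) : ℝ :=
  (sortedAngles t J).getD (j - 1) 0

/-- The average `Δ_av = α_max / N_J`, where `α_max = α_{N_J}` is the largest angle. -/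
def averageAngle (t : ℝ) (J : ℕ) : ℝ :=
  orderedAngle t J (numPoints J) / (numPoints J : ℝ)

open Classical in
/-- The gap distribution function `G_{t,J}`: the number of `j` with `1 ≤ j < N_J` and
`α_{j+1} - α_j ≥ x Δ_av`, divided by `N_J`. -/
def gapDistribution (t : ℝ) (J : ℕ) (x : ℝ) : ℝ :=
  (((Finset.Ico 1 (numPoints J)).filter
      (fun j => x * averageAngle t J ≤ orderedAngle t J (j + 1) - orderedAngle t J j)).card : ℝ)
    / (numPoints J : ℝ)

/-- `G` is the limiting gap distribution function of the observers at `(-t J², 0)`: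
`G x = lim_{J → ∞} G_{t,J}(x)` (the limit exists) for every `x ≥ 0`. -/
def IsLimitingGapDistribution (t : ℝ) (G : ℝ → ℝ) : Prop :=
  ∀ x : ℝ, 0 ≤ x → Tendsto (fun J : ℕ => gapDistribution t J x) atTop (𝓝 (G x))

end MovingObserver

end

/-! Write `p = (a, n)` and `r = (t J² + a) / n`. The line of sight through `p` meets the row `n + k`
at abscissa `a + k r`, and the signed distance from there to a lattice point `q` of that row is the
`offset`. The angles are small, of size about `n / (t J²)`, and the average gap is about `1 / (2 t
J³)`, so an angle difference below `x Δ_av` means, to leading order, an offset below `θ = x t J / (2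
n)`. Hence the gap distribution is governed by the number of points with no close successor.

If `n < x t J / 2`, then `θ > 1` and the left neighbour in the same row is already close. These rows
contribute `x t J²` close points to leading order. In a higher row `θ ≤ 1`, so the same row is
useless. As `t > 1`, `r ≥ J + 1` for large `J`, so two or more rows away the line has left the
rectangle. A close successor must lie in row `n ± 1` and is then detected by the fractional part of
`± r` being below `θ`. About `2 J - t J² / n` abscissae have their line meet the rectangle in row `n
+ 1`, and as many in row `n - 1`. This number is positive only for `n > t J / 2`, and no `a` belongs
to both families. If the fractional parts equidistribute, the close points number `J² x t (1 + ∫ (2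
/ y - t / y²) dy)`, integrated over `y = n / J` from `max (t / 2) (x t / 2)`, capped at `1`, up to
`1`. This gives the empty range for `t > 2`, and the two regimes `x ≤ 1` and `x ≥ 1` for `t ≤ 2`.

Equidistribution holds only on average over rows. In one row the fractional parts run through a
progression of step `1 / n` with `O(J)` terms, and the discrepancy, of the same order `J` as the
main term, is `n / 2` times differences of the periodic second Bernoulli function at phases `± t J²
/ n` plus a smooth function of `n / J` (`abs_card_fract_lt_sub_le`). Its Fourier series converges
absolutely, and each frequency averages to zero over `n` because shifting `n` by `h` turns the phase
by an amount depending on `n / J` (`tendsto_exp_sum`, `tendsto_bern_sum`).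

Coinciding directions produce zero gaps. They are controlled because points with a successor at
offset `0` lie in `closePoints t J η` for every `η > 0`, whose density tends to `0` with `η`
(`eventually_gapCount_bounds`). -/

namespace MovingObserver

/-! ### Riemann sums over the upper rows. -/

theorem tendsto_riemann_sum {F : ℝ → ℝ} (hF : Continuous F) {c : ℝ} (hc0 : 0 ≤ c) (hc1 : c ≤ 1) :
    Tendsto (fun J : ℕ => (1 / (J : ℝ)) * ∑ n ∈ Finset.Ico ⌈c * J⌉₊ J, F (n / J)) atTop
      (𝓝 (∫ y in c..1, F y)) := by
  have hint : ∀ a b : ℝ, IntervalIntegrable F MeasureTheory.volume a b :=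
    fun a b => hF.intervalIntegrable a b
  have hlow : Tendsto (fun J : ℕ => ∫ y in ((⌈c * J⌉₊ : ℝ) / J)..1, F y) atTop
      (𝓝 (∫ y in c..1, F y)) := by
    have h1 : Continuous (fun x : ℝ => ∫ y in x..1, F y) := by
      have : (fun x : ℝ => ∫ y in x..1, F y) = fun x => -∫ y in (1 : ℝ)..x, F y := by
        funext x; rw [intervalIntegral.integral_symm]
      rw [this]
      exact (intervalIntegral.continuous_primitive hint 1).neg
    have h2 : Tendsto (fun J : ℕ => (⌈c * J⌉₊ : ℝ) / J) atTop (𝓝 c) :=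
      (tendsto_nat_ceil_mul_div_atTop hc0).comp tendsto_natCast_atTop_atTop
    exact (h1.tendsto c).comp h2
  refine tendsto_of_tendsto_of_dist hlow ?_
  rw [Metric.tendsto_nhds]
  intro ε hε
  have huc : UniformContinuousOn F (Set.Icc 0 1) :=
    isCompact_Icc.uniformContinuousOn_of_continuous hF.continuousOn
  rw [Metric.uniformContinuousOn_iff] at huc
  obtain ⟨δ, hδ, hd⟩ := huc (ε / 2) (by positivity)
  obtain ⟨K, hK⟩ := exists_nat_gt (1 / δ)
  filter_upwards [eventually_ge_atTop (K + 1)] with J hJ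
  have hJ1 : 1 ≤ J := by omega
  have hJ0 : (0 : ℝ) < J := by exact_mod_cast hJ1
  have hJδ : 1 / (J : ℝ) < δ := by
    have : (K : ℝ) < J := by exact_mod_cast (by omega : K < J)
    rw [div_lt_iff₀ hJ0]
    rw [div_lt_iff₀ hδ] at hK
    nlinarith
  set m := ⌈c * J⌉₊ with hm
  have hmJ : m ≤ J := by
    rw [hm]; apply Nat.ceil_le.2; nlinarith
  have hsplit : ∫ y in ((m : ℝ) / J)..1, F y
      = ∑ k ∈ Finset.Ico m J, ∫ y in ((k : ℝ) / J)..(((k + 1 : ℕ) : ℝ) / J), F y := by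
    rw [intervalIntegral.sum_integral_adjacent_intervals_Ico
      (a := fun k : ℕ => (k : ℝ) / J) hmJ (fun k _ => hint _ _), div_self hJ0.ne']
  have hterm : ∀ k ∈ Finset.Ico m J,
      |(∫ y in ((k : ℝ) / J)..(((k + 1 : ℕ) : ℝ) / J), F y) - 1 / (J : ℝ) * F (k / J)|
        ≤ ε / 2 * (1 / J) := by
    intro k hk
    rw [Finset.mem_Ico] at hk
    have hlen : ((k + 1 : ℕ) : ℝ) / J - (k : ℝ) / J = 1 / J := by
      push_cast; ring
    have hc : 1 / (J : ℝ) * F (k / J)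
        = ∫ y in ((k : ℝ) / J)..(((k + 1 : ℕ) : ℝ) / J), F (k / J) := by
      rw [intervalIntegral.integral_const, hlen, smul_eq_mul]
    rw [hc, ← intervalIntegral.integral_sub (hint _ _) (by simp)]
    have hle : (k : ℝ) / J ≤ ((k + 1 : ℕ) : ℝ) / J := by
      have : 0 < 1 / (J : ℝ) := by positivity
      linarith
    have := intervalIntegral.norm_integral_le_of_norm_le_const (a := (k : ℝ) / J)
      (b := ((k + 1 : ℕ) : ℝ) / J) (C := ε / 2) (f := fun y => F y - F (k / J)) ?_
    · rw [hlen, abs_of_pos (by positivity : 0 < 1 / (J : ℝ))] at this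
      exact this
    · intro y hy
      rw [Set.uIoc_of_le hle] at hy
      have hk0 : 0 ≤ (k : ℝ) / J := by positivity
      have hk1 : ((k + 1 : ℕ) : ℝ) / J ≤ 1 := by
        rw [div_le_one hJ0]; exact_mod_cast hk.2
      have := hd y ⟨by linarith [hy.1], by linarith [hy.2]⟩ (k / J) ⟨hk0, by linarith⟩ (by
        rw [Real.dist_eq, abs_of_pos (by linarith [hy.1])]
        linarith [hy.2])
      rw [Real.dist_eq] at this
      exact this.le
  rw [Real.dist_0_eq_abs, Real.dist_eq, abs_abs, hsplit, Finset.mul_sum, ← Finset.sum_sub_distrib]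
  calc _ ≤ ∑ k ∈ Finset.Ico m J, ε / 2 * (1 / (J : ℝ)) :=
        (Finset.abs_sum_le_sum_abs _ _).trans (Finset.sum_le_sum hterm)
    _ = ((J - m : ℕ) : ℝ) * (ε / 2 * (1 / J)) := by simp
    _ ≤ J * (ε / 2 * (1 / J)) := by
        have : ((J - m : ℕ) : ℝ) ≤ J := by exact_mod_cast Nat.sub_le _ _
        gcongr
    _ < ε := by
        have : (J : ℝ) * (ε / 2 * (1 / J)) = ε / 2 := by field_simp
        linarith

/-! ### Cancellation in exponential sums with phase `κ J² / n`. -/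

/-- `e^{ix}`. -/
noncomputable def expI (x : ℝ) : ℂ := Complex.exp (Complex.I * x)

theorem norm_expI (x : ℝ) : ‖expI x‖ = 1 := Complex.norm_exp_I_mul_ofReal x

theorem expI_add (x y : ℝ) : expI (x + y) = expI x * expI y := by
  simp [expI, mul_add, Complex.exp_add]

theorem continuous_expI : Continuous expI := by unfold expI; fun_prop

theorem norm_expI_sub_expI_le (x y : ℝ) : ‖expI x - expI y‖ ≤ |x - y| := by
  have h : expI x - expI y = expI y * (expI (x - y) - 1) := by
    rw [mul_sub, ← expI_add]; simp
  rw [h, norm_mul, norm_expI, one_mul]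
  exact Real.norm_exp_I_mul_ofReal_sub_one_le

/-- The normalized geometric sum `H⁻¹ ∑_{h < H} e^{-ihs}`. -/
noncomputable def geomMean (H : ℕ) (s : ℝ) : ℂ := (1 / (H : ℂ)) * ∑ h ∈ Finset.range H, expI (-(h * s))

theorem continuous_geomMean (H : ℕ) : Continuous (geomMean H) := by
  unfold geomMean
  refine continuous_const.mul (continuous_finsetSum _ fun h _ => ?_)
  exact continuous_expI.comp (by fun_prop)

theorem norm_geomMean_le (H : ℕ) (s : ℝ) : ‖geomMean H s‖ ≤ 1 := by
  unfold geomMean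
  rw [norm_mul]
  have h1 : ‖∑ h ∈ Finset.range H, expI (-(h * s))‖ ≤ H := by
    refine (norm_sum_le _ _).trans ?_
    simp [norm_expI]
  have h2 : ‖(1 / (H : ℂ))‖ = 1 / (H : ℝ) := by simp
  rw [h2]
  rcases Nat.eq_zero_or_pos H with h | h
  · subst h; simp
  · have : (0 : ℝ) < H := by exact_mod_cast h
    calc 1 / (H : ℝ) * ‖∑ h ∈ Finset.range H, expI (-(h * s))‖ ≤ 1 / (H : ℝ) * H := by gcongr
      _ = 1 := by field_simp

theorem tendsto_geomMean {s : ℝ} (hs : expI (-s) ≠ 1) :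
    Tendsto (fun H : ℕ => ‖geomMean H s‖) atTop (𝓝 0) := by
  have hpow : ∀ h : ℕ, expI (-(h * s)) = expI (-s) ^ h := by
    intro h
    simp only [expI, ← Complex.exp_nat_mul]
    congr 1; push_cast; ring
  have hb : ∀ H : ℕ, ‖geomMean H s‖ ≤ (2 / ‖expI (-s) - 1‖) * (1 / (H : ℝ)) := by
    intro H
    unfold geomMean
    simp only [hpow]
    rw [geom_sum_eq hs, norm_mul]
    have h2 : ‖(1 / (H : ℂ))‖ = 1 / (H : ℝ) := by simp
    have h3 : ‖expI (-s) ^ H - 1‖ ≤ 2 := by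
      refine (norm_sub_le _ _).trans ?_
      rw [norm_pow, norm_expI]; norm_num
    rw [h2, norm_div, mul_comm]
    gcongr
  refine squeeze_zero (fun _ => norm_nonneg _) hb ?_
  simpa using tendsto_one_div_atTop_nhds_zero_nat.const_mul (2 / ‖expI (-s) - 1‖)

/-- The geometric mean tends to `0` unless `κ / y²` is a multiple of `2π`, which happens for
countably many `y > 0` only, so dominated convergence applies. The truncation `max y c` keeps the
integrand continuous on the whole line. -/
theorem tendsto_integral_geomMean {κ : ℝ} (hκ : 0 < κ) {c : ℝ} (hc0 : 0 < c) (hc1 : c ≤ 1) :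
    Tendsto (fun H : ℕ => ∫ y in c..1, ‖geomMean H (κ / (max y c) ^ 2)‖) atTop (𝓝 0) := by
  have hcont : ∀ H : ℕ, Continuous fun y : ℝ => ‖geomMean H (κ / (max y c) ^ 2)‖ := by
    intro H
    refine ((continuous_geomMean H).comp ?_).norm
    refine continuous_const.div (by fun_prop) fun y => ?_
    have : 0 < max y c := lt_max_of_lt_right hc0
    positivity
  have := intervalIntegral.tendsto_integral_filter_of_dominated_convergence (a := c) (b := 1)
    (μ := MeasureTheory.volume) (l := atTop) (f := fun _ => (0 : ℝ))
    (F := fun (H : ℕ) y => ‖geomMean H (κ / (max y c) ^ 2)‖) (fun _ => 1)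
    (Eventually.of_forall fun H => (hcont H).aestronglyMeasurable)
    (Eventually.of_forall fun H => Eventually.of_forall fun y _ => by
      rw [norm_norm]; exact norm_geomMean_le _ _)
    (by simp) ?_
  · simpa using this
  · have hcount : (Set.range fun k : ℤ => Real.sqrt (κ / (2 * Real.pi * k))).Countable :=
      Set.countable_range _
    have hae := hcount.ae_notMem MeasureTheory.volume
    filter_upwards [hae] with y hy hyc
    rw [Set.uIoc_of_le hc1] at hyc
    refine tendsto_geomMean fun h => hy ?_
    unfold expI at h
    rw [Complex.exp_eq_one_iff] at h
    obtain ⟨k, hk⟩ := h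
    have hy0 : 0 < y := hc0.trans hyc.1
    rw [max_eq_left hyc.1.le] at hk
    have hk' : -(κ / y ^ 2) = k * (2 * Real.pi) := by
      have := congrArg Complex.im hk
      simp only [Complex.mul_im, Complex.I_re, Complex.I_im, Complex.ofReal_re, Complex.ofReal_im,
        Complex.mul_re, Complex.intCast_re, Complex.intCast_im, Complex.re_ofNat,
        Complex.im_ofNat] at this
      linarith
    refine ⟨-k, ?_⟩
    have : κ / (2 * Real.pi * ((-k : ℤ) : ℝ)) = y ^ 2 := by
      have h0 : 0 < κ / y ^ 2 := by positivity
      have h1 : 2 * Real.pi * ((-k : ℤ) : ℝ) = κ / y ^ 2 := by push_cast; linarith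
      rw [h1]; field_simp
    simp only [this]
    exact Real.sqrt_sq hy0.le

theorem natCast_div_ge_of_mem {c : ℝ} {J n : ℕ} (hJ : 0 < J)
    (hn : n ∈ Finset.Ico ⌈c * J⌉₊ J) : c ≤ (n : ℝ) / J ∧ (n : ℝ) / J ≤ 1 := by
  rw [Finset.mem_Ico, Nat.ceil_le] at hn
  have hJ0 : (0 : ℝ) < J := by exact_mod_cast hJ
  constructor
  · rw [le_div_iff₀ hJ0]; exact hn.1
  · rw [div_le_one hJ0]; exact_mod_cast hn.2.le

/-- The difference telescopes: a shift by `h` replaces at most `h` terms at each end. -/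
theorem norm_sum_Ico_shift_sub_le {a : ℕ → ℂ} {U : ℝ} {m J : ℕ} (hmJ : m ≤ J) (h : ℕ)
    (ha : ∀ n, n ≤ J + h → ‖a n‖ ≤ U) :
    ‖∑ n ∈ Finset.Ico m J, (a (n + h) - a n)‖ ≤ 2 * h * U := by
  induction h with
  | zero => simp
  | succ h ih =>
    have h1 : ∑ n ∈ Finset.Ico m J, (a (n + (h + 1)) - a n)
        = ∑ n ∈ Finset.Ico m J, (a (n + h) - a n) + (a (J + h) - a (m + h)) := by
      have h2 := Finset.sum_Ico_sub (fun n => a (n + h)) hmJ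
      rw [← h2, ← Finset.sum_add_distrib]
      refine Finset.sum_congr rfl fun n _ => ?_
      rw [show n + 1 + h = n + (h + 1) by ring]; ring
    rw [h1]
    refine (norm_add_le _ _).trans ?_
    have h3 := ih fun n hn => ha n (by omega)
    have h4 : ‖a (J + h) - a (m + h)‖ ≤ U + U :=
      (norm_sub_le _ _).trans (add_le_add (ha _ (by omega)) (ha _ (by omega)))
    push_cast
    linarith

/-- First-order expansion of `κ J² / (x + h)` at `x`. The remainder is exactly `κ h² J² / (x² y)`,
and `x` and `y` are both at least `c J`. -/
theorem abs_inv_shift_sub_le {c x y J h κ : ℝ} (hκ : 0 ≤ κ) (hc : 0 < c) (hJ : 0 < J)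
    (hx : c * J ≤ x) (hh : 0 ≤ h) (hy : y = x + h) :
    |κ * J ^ 2 / y - (κ * J ^ 2 / x - h * (κ / (x / J) ^ 2))| ≤ κ * h ^ 2 / c ^ 3 * (1 / J) := by
  have hx0 : 0 < x := lt_of_lt_of_le (by positivity) hx
  have hy0 : 0 < y := by linarith
  have h1 : κ * J ^ 2 / y - (κ * J ^ 2 / x - h * (κ / (x / J) ^ 2))
      = κ * h ^ 2 * J ^ 2 / (x ^ 2 * y) := by
    subst hy
    field_simp
    ring
  rw [h1, abs_of_nonneg (by positivity)]
  have h2 : κ * h ^ 2 / c ^ 3 * (1 / J) = κ * h ^ 2 * J ^ 2 / ((c * J) ^ 2 * (c * J)) := by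
    field_simp
  rw [h2]
  gcongr
  linarith

/-- Shifting the summation index by a fixed `h` multiplies the summand by a slowly varying
phase. -/
theorem tendsto_sum_mul_one_sub_phase {u : ℝ → ℂ} (hu : Continuous u) {κ : ℝ} (hκ : 0 < κ)
    {c : ℝ} (hc0 : 0 < c) (hc1 : c ≤ 1) (h : ℕ) :
    Tendsto (fun J : ℕ => (1 / (J : ℂ)) * ∑ n ∈ Finset.Ico ⌈c * J⌉₊ J,
      u (n / J) * expI (κ * J ^ 2 / n) * (1 - expI (-(h * (κ / ((n : ℝ) / J) ^ 2))))) atTop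
      (𝓝 0) := by
  -- The interval reaches `2` because the shifted indices `n + h` may exceed `J`, but not `2 J`.
  obtain ⟨U, hU⟩ : ∃ U, ∀ x ∈ Set.Icc (0 : ℝ) 2, ‖u x‖ ≤ U :=
    isCompact_Icc.exists_bound_of_continuousOn hu.continuousOn
  have huc : UniformContinuousOn u (Set.Icc 0 2) :=
    isCompact_Icc.uniformContinuousOn_of_continuous hu.continuousOn
  rw [Metric.uniformContinuousOn_iff] at huc
  have hU0 : 0 ≤ U := (norm_nonneg _).trans (hU 0 (by norm_num))
  rw [Metric.tendsto_nhds]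
  intro ε hε
  obtain ⟨δ, hδ, hd⟩ := huc (ε / 4) (by positivity)
  have e1 : ∀ᶠ J : ℕ in atTop, 2 * h * U * (1 / (J : ℝ)) < ε / 4 := by
    have : Tendsto (fun J : ℕ => 2 * h * U * (1 / (J : ℝ))) atTop (𝓝 (2 * h * U * 0)) :=
      tendsto_one_div_atTop_nhds_zero_nat.const_mul _
    rw [mul_zero] at this
    exact this.eventually_lt_const (by positivity)
  have e2 : ∀ᶠ J : ℕ in atTop, U * (κ * h ^ 2 / c ^ 3) * (1 / (J : ℝ)) < ε / 4 := by
    have : Tendsto (fun J : ℕ => U * (κ * h ^ 2 / c ^ 3) * (1 / (J : ℝ))) atTop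
        (𝓝 (U * (κ * h ^ 2 / c ^ 3) * 0)) :=
      tendsto_one_div_atTop_nhds_zero_nat.const_mul _
    rw [mul_zero] at this
    exact this.eventually_lt_const (by positivity)
  have e3 : ∀ᶠ J : ℕ in atTop, h * (1 / (J : ℝ)) < δ := by
    have : Tendsto (fun J : ℕ => h * (1 / (J : ℝ))) atTop (𝓝 (h * 0)) :=
      tendsto_one_div_atTop_nhds_zero_nat.const_mul _
    rw [mul_zero] at this
    exact this.eventually_lt_const hδ
  filter_upwards [e1, e2, e3, eventually_ge_atTop (h + 1)] with J h1 h2 h3 h4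
  have hJ : 0 < J := by omega
  have hJ0 : (0 : ℝ) < J := by exact_mod_cast hJ
  rw [dist_zero_right, norm_mul]
  have hn1 : ‖(1 / (J : ℂ))‖ = 1 / (J : ℝ) := by simp
  rw [hn1]
  set m := ⌈c * J⌉₊ with hm
  have hmJ : m ≤ J := by
    rw [hm]; apply Nat.ceil_le.2; nlinarith
  set a : ℕ → ℂ := fun n => u (n / J) * expI (κ * J ^ 2 / n) with ha
  have hshift := norm_sum_Ico_shift_sub_le (a := a) (U := U) hmJ h (by
    intro n hn
    rw [ha]; simp only [norm_mul, norm_expI, mul_one]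
    apply hU
    refine ⟨by positivity, ?_⟩
    rw [div_le_iff₀ hJ0]
    have : (n : ℝ) ≤ (2 * J : ℕ) := by exact_mod_cast (by omega : n ≤ 2 * J)
    simpa using this)
  have hterm : ∀ n ∈ Finset.Ico m J,
      ‖a (n + h) - a n * expI (-(h * (κ / ((n : ℝ) / J) ^ 2)))‖ ≤ ε / 2 := by
    intro n hn
    have hnJ := natCast_div_ge_of_mem hJ hn
    have hxc : c * J ≤ n := by rw [Finset.mem_Ico, hm, Nat.ceil_le] at hn; exact hn.1
    have hu1 : ‖u ((n + h : ℕ) / J) - u (n / J)‖ ≤ ε / 4 := by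
      have hlen : ((n + h : ℕ) : ℝ) / J - n / J = h * (1 / J) := by push_cast; ring
      have hn0 : (0 : ℝ) ≤ n / J := by positivity
      have hh1 : h * (1 / (J : ℝ)) ≤ 1 := by
        rw [mul_one_div, div_le_one hJ0]; exact_mod_cast (by omega : h ≤ J)
      have hh0 : 0 ≤ h * (1 / (J : ℝ)) := by positivity
      have := hd (((n + h : ℕ) : ℝ) / J) ⟨by positivity, by linarith [hnJ.2]⟩ (n / J)
        ⟨hn0, by linarith [hnJ.2]⟩ (by rw [Real.dist_eq, hlen, abs_of_nonneg hh0]; exact h3)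
      rw [dist_eq_norm] at this
      exact this.le
    have hph := abs_inv_shift_sub_le (h := h) (y := ((n + h : ℕ) : ℝ)) hκ.le hc0 hJ0 hxc
      (by positivity) (by push_cast; ring)
    have hun : ‖u (n / J)‖ ≤ U := hU _ ⟨by positivity, by linarith [hnJ.2]⟩
    have hdec : a (n + h) - a n * expI (-(h * (κ / ((n : ℝ) / J) ^ 2)))
        = (u ((n + h : ℕ) / J) - u (n / J)) * expI (κ * J ^ 2 / (n + h : ℕ))
          + u (n / J) * (expI (κ * J ^ 2 / (n + h : ℕ))
            - expI (κ * J ^ 2 / n - h * (κ / ((n : ℝ) / J) ^ 2))) := by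
      rw [ha]; simp only [sub_eq_add_neg (κ * (J : ℝ) ^ 2 / n), expI_add]
      ring
    rw [hdec]
    refine (norm_add_le _ _).trans ?_
    rw [norm_mul, norm_mul, norm_expI, mul_one]
    have hb := (norm_expI_sub_expI_le (κ * J ^ 2 / (n + h : ℕ))
      (κ * J ^ 2 / n - h * (κ / ((n : ℝ) / J) ^ 2))).trans hph
    have : ‖u (n / J)‖ * ‖expI (κ * J ^ 2 / (n + h : ℕ))
            - expI (κ * J ^ 2 / n - h * (κ / ((n : ℝ) / J) ^ 2))‖
            ≤ U * (κ * h ^ 2 / c ^ 3 * (1 / J)) := by gcongr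
    linarith
  have hsum : ∑ n ∈ Finset.Ico m J,
      u (n / J) * expI (κ * J ^ 2 / n) * (1 - expI (-(h * (κ / ((n : ℝ) / J) ^ 2))))
      = ∑ n ∈ Finset.Ico m J, (a (n + h) - a n * expI (-(h * (κ / ((n : ℝ) / J) ^ 2))))
        - ∑ n ∈ Finset.Ico m J, (a (n + h) - a n) := by
    rw [← Finset.sum_sub_distrib]
    refine Finset.sum_congr rfl fun n _ => ?_
    rw [ha]; ring
  rw [hsum]
  have hs1 : ‖∑ n ∈ Finset.Ico m J, (a (n + h) - a n * expI (-(h * (κ / ((n : ℝ) / J) ^ 2))))‖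
      ≤ J * (ε / 2) := by
    refine (norm_sum_le _ _).trans ((Finset.sum_le_sum hterm).trans ?_)
    rw [Finset.sum_const, nsmul_eq_mul, Nat.card_Ico]
    have : ((J - m : ℕ) : ℝ) ≤ J := by exact_mod_cast Nat.sub_le _ _
    gcongr
  calc 1 / (J : ℝ) * _ ≤ 1 / (J : ℝ) * (J * (ε / 2) + 2 * h * U) := by
        gcongr
        exact (norm_sub_le _ _).trans (add_le_add hs1 hshift)
    _ = ε / 2 + 2 * h * U * (1 / J) := by field_simp
    _ < ε := by linarith

/-- A van der Corput type argument: the sum is nearly unchanged when its terms are multiplied by the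
phase of a shift by `h`, hence also when they are multiplied by the mean of these phases over `h <
H`. That mean is small for most `n / J` once `H` is large. -/
theorem tendsto_exp_sum {u : ℝ → ℂ} (hu : Continuous u) {κ : ℝ} (hκ : 0 < κ)
    {c : ℝ} (hc0 : 0 < c) (hc1 : c ≤ 1) :
    Tendsto (fun J : ℕ => (1 / (J : ℂ)) * ∑ n ∈ Finset.Ico ⌈c * J⌉₊ J,
      u (n / J) * expI (κ * J ^ 2 / n)) atTop (𝓝 0) := by
  obtain ⟨U, hU⟩ : ∃ U, ∀ x ∈ Set.Icc (0 : ℝ) 2, ‖u x‖ ≤ U :=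
    isCompact_Icc.exists_bound_of_continuousOn hu.continuousOn
  have hU0 : 0 ≤ U := (norm_nonneg _).trans (hU 0 (by norm_num))
  rw [Metric.tendsto_nhds]
  intro ε hε
  have hint := (tendsto_integral_geomMean hκ hc0 hc1).const_mul U
  rw [mul_zero] at hint
  -- `H` is fixed before `J` grows, so that only finitely many shifts have to be controlled.
  obtain ⟨H, hH, hHpos⟩ := ((hint.eventually_lt_const (by positivity : (0 : ℝ) < ε / 2)).and
    (eventually_ge_atTop 1)).exists
  have hH0 : (H : ℂ) ≠ 0 := by exact_mod_cast (by omega : H ≠ 0)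
  have hcont : Continuous fun y : ℝ => ‖geomMean H (κ / (max y c) ^ 2)‖ := by
    refine ((continuous_geomMean H).comp ?_).norm
    refine continuous_const.div (by fun_prop) fun y => ?_
    have : 0 < max y c := lt_max_of_lt_right hc0
    positivity
  have hR := (tendsto_riemann_sum hcont hc0.le hc1).const_mul U
  have hS : Tendsto (fun J : ℕ => (1 / (H : ℂ)) * ∑ h ∈ Finset.range H,
      ((1 / (J : ℂ)) * ∑ n ∈ Finset.Ico ⌈c * J⌉₊ J,
      u (n / J) * expI (κ * J ^ 2 / n) * (1 - expI (-(h * (κ / ((n : ℝ) / J) ^ 2)))))) atTop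
      (𝓝 0) := by
    have := (tendsto_finsetSum (Finset.range H) fun h _ =>
      tendsto_sum_mul_one_sub_phase hu hκ hc0 hc1 h).const_mul (1 / (H : ℂ))
    simpa using this
  rw [Metric.tendsto_nhds] at hS
  filter_upwards [hS (ε / 2) (by positivity), hR.eventually_lt_const hH,
    eventually_ge_atTop 1] with J h1 h2 hJ
  rw [dist_zero_right] at h1 ⊢
  -- Each term is split by `1 = H⁻¹ ∑ (1 - e^{-ihs}) + geomMean H s` with `s = κ / (n / J)²`.
  have hid : (1 / (J : ℂ)) * ∑ n ∈ Finset.Ico ⌈c * J⌉₊ J, u (n / J) * expI (κ * J ^ 2 / n)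
      = (1 / (H : ℂ)) * ∑ h ∈ Finset.range H, ((1 / (J : ℂ)) * ∑ n ∈ Finset.Ico ⌈c * J⌉₊ J,
        u (n / J) * expI (κ * J ^ 2 / n) * (1 - expI (-(h * (κ / ((n : ℝ) / J) ^ 2)))))
      + (1 / (J : ℂ)) * ∑ n ∈ Finset.Ico ⌈c * J⌉₊ J, u (n / J) * expI (κ * J ^ 2 / n)
          * geomMean H (κ / ((n : ℝ) / J) ^ 2) := by
    rw [← Finset.mul_sum, Finset.sum_comm, mul_left_comm, ← mul_add]
    congr 1
    rw [Finset.mul_sum, ← Finset.sum_add_distrib]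
    refine Finset.sum_congr rfl fun n _ => ?_
    rw [← Finset.mul_sum, Finset.sum_sub_distrib]
    unfold geomMean
    simp only [Finset.sum_const, Finset.card_range, nsmul_eq_mul, mul_one]
    field_simp
    ring
  rw [hid]
  refine (norm_add_le _ _).trans_lt ?_
  have hn1 : ‖(1 / (J : ℂ))‖ = 1 / (J : ℝ) := by simp
  have h3 : ‖(1 / (J : ℂ)) * ∑ n ∈ Finset.Ico ⌈c * J⌉₊ J, u (n / J) * expI (κ * J ^ 2 / n)
          * geomMean H (κ / ((n : ℝ) / J) ^ 2)‖ ≤ U * (1 / (J : ℝ) *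
          ∑ n ∈ Finset.Ico ⌈c * J⌉₊ J, ‖geomMean H (κ / (max ((n : ℝ) / J) c) ^ 2)‖) := by
    rw [norm_mul, hn1, mul_left_comm, Finset.mul_sum]
    gcongr
    refine (norm_sum_le _ _).trans (Finset.sum_le_sum fun n hn => ?_)
    have hnJ := natCast_div_ge_of_mem hJ hn
    rw [norm_mul, norm_mul, norm_expI, mul_one, max_eq_left hnJ.1]
    gcongr
    exact hU _ ⟨by positivity, by linarith⟩
  linarith

/-! ### The periodic second Bernoulli function, averaged over rows. -/

/-- The periodic second Bernoulli polynomial. -/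
noncomputable def bern (x : ℝ) : ℝ := Int.fract x ^ 2 - Int.fract x + 1 / 6

theorem hasSum_bern (x : ℝ) :
    HasSum (fun k : ℕ => 1 / Real.pi ^ 2 * (1 / (k : ℝ) ^ 2 * Real.cos (2 * Real.pi * k * x)))
      (bern x) := by
  have h := hasSum_one_div_nat_pow_mul_cos (k := 1) one_ne_zero (x := Int.fract x)
    ⟨Int.fract_nonneg x, (Int.fract_lt_one x).le⟩
  have hB : Polynomial.eval (Int.fract x) (Polynomial.map (algebraMap ℚ ℝ)
      (Polynomial.bernoulli (2 * 1))) = bern x := by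
    rw [show 2 * 1 = 2 from rfl]
    simp [Polynomial.bernoulli, Finset.sum_range_succ, bern, bernoulli_one, bernoulli_two]
    ring
  rw [hB] at h
  have h2 := h.mul_left (1 / Real.pi ^ 2)
  have hv : 1 / Real.pi ^ 2 * ((-1) ^ (1 + 1) * (2 * Real.pi) ^ (2 * 1) / 2 /
      ((2 * 1).factorial : ℝ) * bern x) = bern x := by
    have := Real.pi_pos
    norm_num [Nat.factorial]
    field_simp
  rw [hv] at h2
  refine h2.congr_fun fun k => ?_
  simp only [mul_one]
  rw [← Int.self_sub_floor, ← Real.cos_sub_int_mul_two_pi (2 * Real.pi * k * x) (k * ⌊x⌋)]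
  congr 3; push_cast; ring

/-- The Fourier coefficients are of size `1 / k²`, so limit and series may be exchanged. Each
frequency `k ≥ 1` is an exponential sum whose amplitude absorbs the smooth perturbation `g`. -/
theorem tendsto_bern_sum {t : ℝ} (ht : 0 < t) {g : ℝ → ℝ} (hg : Continuous g)
    {c : ℝ} (hc0 : 0 < c) (hc1 : c ≤ 1) :
    Tendsto (fun J : ℕ => (1 / (J : ℝ)) * ∑ n ∈ Finset.Ico ⌈c * J⌉₊ J,
      (n : ℝ) / J * bern (t * J ^ 2 / n + g (n / J))) atTop (𝓝 0) := by
  have hcos : ∀ k : ℕ, 0 < k → Tendsto (fun J : ℕ => (1 / (J : ℝ)) *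
      ∑ n ∈ Finset.Ico ⌈c * J⌉₊ J, (n : ℝ) / J *
        Real.cos (2 * Real.pi * k * (t * J ^ 2 / n + g (n / J)))) atTop (𝓝 0) := by
    intro k hk
    have hk0 : (0 : ℝ) < k := by exact_mod_cast hk
    have hκ : 0 < 2 * Real.pi * k * t := by have := Real.pi_pos; positivity
    have h1 := tendsto_exp_sum (u := fun y => (y : ℂ) * expI (2 * Real.pi * k * g y))
      (Complex.continuous_ofReal.mul (continuous_expI.comp (by fun_prop))) hκ hc0 hc1
    have h2 := (Complex.continuous_re.tendsto 0).comp h1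
    rw [Complex.zero_re] at h2
    refine h2.congr fun J => ?_
    simp only [Function.comp_apply]
    rw [show (1 / (J : ℂ)) = ((1 / (J : ℝ) : ℝ) : ℂ) by push_cast; rfl, Complex.re_ofReal_mul,
      Complex.re_sum]
    congr 1
    refine Finset.sum_congr rfl fun n _ => ?_
    rw [mul_assoc, ← expI_add, Complex.re_ofReal_mul]
    congr 1
    unfold expI
    rw [mul_comm Complex.I, Complex.exp_ofReal_mul_I_re]
    congr 1
    ring
  have hbound : Summable fun k : ℕ => 1 / Real.pi ^ 2 * (1 / (k : ℝ) ^ 2) :=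
    (Real.summable_one_div_nat_pow.2 (by norm_num)).mul_left _
  have key := tendsto_tsum_of_dominated_convergence (𝓕 := atTop) (β := ℕ)
    (f := fun (J : ℕ) (k : ℕ) => 1 / Real.pi ^ 2 * (1 / (k : ℝ) ^ 2) * ((1 / (J : ℝ)) *
      ∑ n ∈ Finset.Ico ⌈c * J⌉₊ J, (n : ℝ) / J *
        Real.cos (2 * Real.pi * k * (t * J ^ 2 / n + g (n / J)))))
    (g := fun _ => (0 : ℝ)) hbound ?_ ?_
  · rw [tsum_zero] at key
    refine key.congr fun J => ?_
    have : ∀ n : ℕ, HasSum (fun k : ℕ => 1 / (J : ℝ) * ((n : ℝ) / J *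
        (1 / Real.pi ^ 2 * (1 / (k : ℝ) ^ 2 *
          Real.cos (2 * Real.pi * k * (t * J ^ 2 / n + g (n / J)))))))
        (1 / (J : ℝ) * ((n : ℝ) / J * bern (t * J ^ 2 / n + g (n / J)))) :=
      fun n => ((hasSum_bern _).mul_left _).mul_left _
    have h2 := hasSum_sum (s := Finset.Ico ⌈c * J⌉₊ J) fun n _ => this n
    rw [Finset.mul_sum, ← h2.tsum_eq]
    refine tsum_congr fun k => ?_
    rw [Finset.mul_sum, Finset.mul_sum]
    refine Finset.sum_congr rfl fun n _ => ?_
    ring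
  · intro k
    rcases Nat.eq_zero_or_pos k with hk | hk
    -- There is no constant term: the coefficient at `k = 0` is `1 / 0 = 0`.
    · subst hk; simp
    · have := (hcos k hk).const_mul (1 / Real.pi ^ 2 * (1 / (k : ℝ) ^ 2))
      rwa [mul_zero] at this
  · filter_upwards [eventually_ge_atTop 1] with J hJ k
    have hJ0 : (0 : ℝ) < J := by exact_mod_cast hJ
    rw [norm_mul, Real.norm_of_nonneg (by positivity)]
    refine mul_le_of_le_one_right (by positivity) ?_
    rw [norm_mul, Real.norm_of_nonneg (by positivity : 0 ≤ 1 / (J : ℝ)), one_div,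
      inv_mul_le_iff₀ hJ0, mul_one]
    refine (norm_sum_le _ _).trans ((Finset.sum_le_card_nsmul _ _ 1 fun n hn => ?_).trans ?_)
    · have hnJ := natCast_div_ge_of_mem hJ hn
      rw [norm_mul, Real.norm_of_nonneg (by positivity : 0 ≤ (n : ℝ) / J)]
      exact mul_le_one₀ hnJ.2 (norm_nonneg _) (Real.abs_cos_le_one _)
    · rw [nsmul_eq_mul, mul_one, Nat.card_Ico]
      exact_mod_cast Nat.sub_le _ _

/-! ### Fractional parts along arithmetic progressions. -/

theorem bern_neg (x : ℝ) : bern (-x) = bern x := by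
  unfold bern
  by_cases h : Int.fract x = 0
  · rw [h, Int.fract_neg_eq_zero.2 h]
  · rw [Int.fract_neg h]; ring

theorem abs_bern_sub_le (x y : ℝ) : |bern x - bern y| ≤ |x - y| := by
  wlog hxy : x ≤ y generalizing x y
  · rw [abs_sub_comm, abs_sub_comm x]
    exact this y x (le_of_not_ge hxy)
  rw [abs_sub_comm, abs_sub_comm x, abs_of_nonneg (sub_nonneg.2 hxy)]
  have hx0 := Int.fract_nonneg x
  have hx1 := Int.fract_lt_one x
  have hy0 := Int.fract_nonneg y
  have hy1 := Int.fract_lt_one y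
  have hxe := Int.floor_add_fract x
  have hye := Int.floor_add_fract y
  have hfl : ⌊x⌋ ≤ ⌊y⌋ := Int.floor_le_floor hxy
  unfold bern
  rcases hfl.eq_or_lt with h | h
  · rw [h] at hxe
    rw [abs_le]
    constructor <;> nlinarith
  · have h2 : (⌊x⌋ : ℝ) + 1 ≤ ⌊y⌋ := by exact_mod_cast h
    rw [abs_le]
    constructor <;> nlinarith

/-- The sawtooth is half the derivative of `bern`, here replaced by a difference quotient of step `1
/ n`. The error is exactly `1 / (2 n)` in absolute value unless the step reaches or crosses an
integer, which costs at most `1` more. Recording that cost as a difference of floors lets it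
telescope along the progression. -/
theorem abs_fract_sub_half_sub_le {n : ℕ} (hn : 0 < n) (z : ℝ) :
    |(Int.fract z - 1 / 2) - (n : ℝ) / 2 * (bern (z + 1 / n) - bern z)|
      ≤ 1 / (2 * n) + ((⌊z + 1 / n⌋ : ℝ) - ⌊z⌋) := by
  have hn0 : (0 : ℝ) < n := by exact_mod_cast hn
  obtain ⟨h, hh⟩ : ∃ h : ℝ, h = 1 / n := ⟨_, rfl⟩
  have hnh : (n : ℝ) * h = 1 := by rw [hh]; field_simp
  have hh0 : 0 < h := by rw [hh]; positivity
  have hh1 : h ≤ 1 := by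
    rw [hh, div_le_one hn0]; exact_mod_cast hn
  have h2 : 1 / (2 * (n : ℝ)) = h / 2 := by rw [hh]; field_simp
  rw [← hh, h2]
  have hx0 := Int.fract_nonneg z
  have hx1 := Int.fract_lt_one z
  have hxe := Int.floor_add_fract z
  have hye := Int.floor_add_fract (z + h)
  rcases lt_or_ge (Int.fract z + h) 1 with hw | hw
  · have hf : ⌊z + h⌋ = ⌊z⌋ := by
      rw [Int.floor_eq_iff]; constructor <;> linarith
    rw [hf] at hye ⊢
    have hfr : Int.fract (z + h) = Int.fract z + h := by linarith
    have : (Int.fract z - 1 / 2) - (n : ℝ) / 2 * (bern (z + h) - bern z) = - (h / 2) := by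
      unfold bern
      rw [hfr]
      linear_combination (-(2 * Int.fract z + h - 1) / 2) * hnh
    rw [this, abs_neg, abs_of_nonneg (by positivity)]
    linarith
  · have hf : ⌊z + h⌋ = ⌊z⌋ + 1 := by
      rw [Int.floor_eq_iff]; push_cast; constructor <;> linarith
    rw [hf] at hye ⊢
    push_cast at hye ⊢
    have hfr : Int.fract (z + h) = Int.fract z + h - 1 := by linarith
    have : (Int.fract z - 1 / 2) - (n : ℝ) / 2 * (bern (z + h) - bern z)
        = - (h / 2) + n * (Int.fract z + h - 1) := by
      unfold bern
      rw [hfr]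
      linear_combination (-(2 * Int.fract z + h - 1) / 2) * hnh
    have h3 : 0 ≤ n * (Int.fract z + h - 1) := mul_nonneg hn0.le (by linarith)
    have h4 : n * (Int.fract z + h - 1) ≤ n * h := by gcongr; linarith
    rw [this, abs_le]
    constructor <;> linarith

theorem ite_fract_lt_eq {θ : ℝ} (h0 : 0 < θ) (h1 : θ ≤ 1) (x : ℝ) :
    (if Int.fract x < θ then (1 : ℝ) else 0)
      = θ + (Int.fract (x - θ) - 1 / 2) - (Int.fract x - 1 / 2) := by
  have hx0 := Int.fract_nonneg x
  have hx1 := Int.fract_lt_one x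
  have hxe := Int.floor_add_fract x
  have hye := Int.floor_add_fract (x - θ)
  split_ifs with h
  · have hf : ⌊x - θ⌋ = ⌊x⌋ - 1 := by
      rw [Int.floor_eq_iff]; push_cast; constructor <;> linarith
    rw [hf] at hye; push_cast at hye; linarith
  · have hf : ⌊x - θ⌋ = ⌊x⌋ := by
      rw [Int.floor_eq_iff]; constructor <;> linarith
    rw [hf] at hye; linarith

/-- The indicator of `fract < θ` is `θ` plus a difference of two sawtooths, and the sums of the
sawtooths telescope into values of `bern` at the two ends. These end terms are of order `n` and stay
in the main term. -/
theorem abs_card_fract_lt_sub_le {n : ℕ} (hn : 0 < n) {θ : ℝ} (h0 : 0 < θ) (h1 : θ ≤ 1)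
    (z : ℝ) (K : ℕ) :
    |(((Finset.range K).filter fun i : ℕ => Int.fract (z + i / n) < θ).card : ℝ)
      - (θ * K + n / 2 * ((bern (z - θ + K / n) - bern (z - θ)) - (bern (z + K / n) - bern z)))|
      ≤ 3 * (K / n) + 2 := by
  have hn0 : (0 : ℝ) < n := by exact_mod_cast hn
  -- The induction carries the floor differences; each is at most `K / n + 1` in the end, which
  -- gives `3 (K / n) + 2`.
  have key : |(((Finset.range K).filter fun i : ℕ => Int.fract (z + i / n) < θ).card : ℝ)
      - (θ * K + n / 2 * ((bern (z - θ + K / n) - bern (z - θ)) - (bern (z + K / n) - bern z)))|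
      ≤ K / n + ((⌊z - θ + K / n⌋ : ℝ) - ⌊z - θ⌋) + ((⌊z + K / n⌋ : ℝ) - ⌊z⌋) := by
    rw [Finset.card_filter]
    push_cast
    induction K with
    | zero => simp
    | succ K ih =>
      rw [Finset.sum_range_succ, ite_fract_lt_eq h0 h1]
      have e1 := abs_fract_sub_half_sub_le hn (z - θ + K / n)
      have e2 := abs_fract_sub_half_sub_le hn (z + K / n)
      have a1 : z - θ + ((K + 1 : ℕ) : ℝ) / n = z - θ + K / n + 1 / n := by push_cast; ring
      have a2 : z + ((K + 1 : ℕ) : ℝ) / n = z + K / n + 1 / n := by push_cast; ring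
      have a3 : z + K / n - θ = z - θ + K / n := by ring
      have a4 : ((K + 1 : ℕ) : ℝ) / n = K / n + 2 * (1 / (2 * n)) := by
        push_cast; field_simp
      rw [a1, a2, a3, a4]
      rw [abs_le] at e1 e2 ih ⊢
      push_cast
      constructor <;> linarith [e1.1, e1.2, e2.1, e2.2, ih.1, ih.2]
  refine key.trans ?_
  have f1 := Int.floor_le (z - θ + K / n)
  have f2 := Int.lt_floor_add_one (z - θ)
  have f3 := Int.floor_le (z + K / n)
  have f4 := Int.lt_floor_add_one z
  linarith

/-- The number of integers `a` with `-J ≤ a < M` for which the fractional part of `(B + a) / n` is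
less than `θ`. -/
noncomputable def fractCount (J n : ℕ) (B θ : ℝ) (M : ℤ) : ℕ :=
  ((Finset.Ico (-(J : ℤ)) M).filter fun a : ℤ => Int.fract ((B + a) / n) < θ).card

/-- The approximation of `fractCount J n B θ M` for `M` near `X`. -/
noncomputable def fractMain (J n : ℕ) (B θ X : ℝ) : ℝ :=
  θ * (X + J) + n / 2 * ((bern ((B + X) / n - θ) - bern ((B - J) / n - θ))
    - (bern ((B + X) / n) - bern ((B - J) / n)))

theorem fractCount_eq_range (J n : ℕ) (B θ : ℝ) (M : ℤ) :
    fractCount J n B θ M = ((Finset.range (M + J).toNat).filter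
      fun i : ℕ => Int.fract ((B - J) / n + i / n) < θ).card := by
  unfold fractCount
  symm
  refine Finset.card_bij (fun i _ => (i : ℤ) - J) ?_ ?_ ?_
  · intro i hi
    simp only [Finset.mem_filter, Finset.mem_range, Finset.mem_Ico] at hi ⊢
    refine ⟨⟨by omega, by omega⟩, ?_⟩
    have : (B + (((i : ℤ) - J : ℤ) : ℝ)) / n = (B - J) / n + i / n := by push_cast; ring
    rw [this]; exact hi.2
  · intro i _ j _ h
    simpa using h
  · intro a ha
    simp only [Finset.mem_filter, Finset.mem_range, Finset.mem_Ico] at ha ⊢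
    obtain ⟨i, hi⟩ : ∃ i : ℕ, (i : ℤ) = a + J := ⟨(a + J).toNat, by omega⟩
    refine ⟨i, ⟨by omega, ?_⟩, by omega⟩
    have hi' : (i : ℝ) = a + J := by exact_mod_cast hi
    have : (B - J) / n + i / n = (B + a) / n := by rw [hi']; ring
    rw [this]; exact ha.2

theorem fractCount_le {J n : ℕ} {B θ C : ℝ} {M : ℤ} (hC : 0 ≤ C) (hM : (M : ℝ) + J ≤ C) :
    (fractCount J n B θ M : ℝ) ≤ C := by
  have h1 : fractCount J n B θ M ≤ (M + J).toNat := by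
    unfold fractCount
    refine (Finset.card_filter_le _ _).trans ?_
    simp
  have h2 : (((M + J).toNat : ℕ) : ℝ) ≤ C := by
    rcases le_total 0 (M + J) with h | h
    · have : (((M + J).toNat : ℤ) : ℝ) = ((M + J : ℤ) : ℝ) := by rw [Int.toNat_of_nonneg h]
      rw [Int.cast_natCast] at this
      rw [this]; push_cast; exact hM
    · rw [Int.toNat_of_nonpos h]; simpa using hC
  exact (Nat.cast_le.2 h1).trans h2

/-- The integer cutoff `M` may be replaced by a smooth one, `X`: `bern` is 1-Lipschitz, so the
factor `n / 2` is cancelled by the `1 / n` in its arguments and the change costs a multiple of `C`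
only. -/
theorem abs_fractCount_sub_fractMain_le {J n : ℕ} (hn : 0 < n) {B θ X C : ℝ} {M : ℤ}
    (h0 : 0 < θ) (h1 : θ ≤ 1) (hX : 0 ≤ X + J) (hM : |M - X| ≤ C) :
    |(fractCount J n B θ M : ℝ) - fractMain J n B θ X| ≤ 3 * ((X + J + C) / n) + 2 + 2 * C := by
  have hn0 : (0 : ℝ) < n := by exact_mod_cast hn
  rw [fractCount_eq_range]
  set K := (M + J).toNat with hK
  have hKX : |(K : ℝ) - (X + J)| ≤ C := by
    rw [abs_le] at hM ⊢
    rcases le_total 0 (M + J) with h | h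
    · have : ((K : ℤ) : ℝ) = ((M + J : ℤ) : ℝ) := by rw [hK, Int.toNat_of_nonneg h]
      rw [Int.cast_natCast] at this
      push_cast at this
      rw [this]; constructor <;> linarith
    · have : (K : ℝ) = 0 := by rw [hK, Int.toNat_of_nonpos h]; simp
      have h' : (M : ℝ) + J ≤ 0 := by exact_mod_cast h
      rw [this]; constructor <;> linarith
  have hKX' := abs_le.1 hKX
  have key := abs_card_fract_lt_sub_le hn h0 h1 ((B - J) / n) K
  have b1 := abs_bern_sub_le ((B - J) / n - θ + K / n) ((B + X) / n - θ)
  have b2 := abs_bern_sub_le ((B - J) / n + K / n) ((B + X) / n)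
  have d1 : (B - J) / n - θ + K / n - ((B + X) / n - θ) = (K - (X + J)) / n := by ring
  have d2 : (B - J) / n + K / n - (B + X) / n = (K - (X + J)) / n := by ring
  have d3 : |((K : ℝ) - (X + J)) / n| ≤ C / n := by
    rw [abs_div, abs_of_pos hn0]; gcongr
  rw [d1] at b1
  rw [d2] at b2
  have b1' := b1.trans d3
  have b2' := b2.trans d3
  have m1 : |(n : ℝ) / 2 * (bern ((B - J) / n - θ + K / n) - bern ((B + X) / n - θ))| ≤ C / 2 := by
    rw [abs_mul, abs_of_pos (by positivity)]
    calc (n : ℝ) / 2 * _ ≤ n / 2 * (C / n) := by gcongr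
      _ = C / 2 := by field_simp
  have m2 : |(n : ℝ) / 2 * (bern ((B - J) / n + K / n) - bern ((B + X) / n))| ≤ C / 2 := by
    rw [abs_mul, abs_of_pos (by positivity)]
    calc (n : ℝ) / 2 * _ ≤ n / 2 * (C / n) := by gcongr
      _ = C / 2 := by field_simp
  have m3 : |θ * (K - (X + J))| ≤ C := by
    rw [abs_mul, abs_of_pos h0]
    calc θ * _ ≤ 1 * C := by gcongr
      _ = C := one_mul _
  have m4 : (K : ℝ) / n ≤ (X + J + C) / n := by gcongr; linarith
  unfold fractMain
  rw [abs_le] at key m1 m2 m3 ⊢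
  constructor <;> linarith [key.1, key.2, m1.1, m1.2, m2.1, m2.2, m3.1, m3.2]

/-! ### Close successors, row by row. -/

/-- The signed distance from `q` to the point of its row seen in the same direction as `p`; up to a
factor close to `2 p.2 / (t J)` this is the difference of view angles, in units of the average. -/
noncomputable def offset (t : ℝ) (J : ℕ) (p q : ℤ × ℤ) : ℝ :=
  ((q.2 : ℝ) - p.2) * ((t * (J : ℝ) ^ 2 + p.1) / p.2) + p.1 - q.1

/-- Some other lattice point follows `p` at offset less than `x t J / (2 p.2)`. -/
def HasCloseSuccessor (t : ℝ) (J : ℕ) (x : ℝ) (p : ℤ × ℤ) : Prop :=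
  ∃ q ∈ latticePoints J, q ≠ p ∧ 0 ≤ offset t J p q ∧ offset t J p q < x * t * J / (2 * p.2)

/-- The lattice points of the rows `1, …, J - 1`. -/
noncomputable def innerPoints (J : ℕ) : Finset (ℤ × ℤ) :=
  Finset.Icc (-(J : ℤ)) (J : ℤ) ×ˢ Finset.Ico (1 : ℤ) (J : ℤ)

open Classical in
/-- The inner points which have a close successor. -/
noncomputable def closePoints (t : ℝ) (J : ℕ) (x : ℝ) : Finset (ℤ × ℤ) :=
  (innerPoints J).filter (HasCloseSuccessor t J x)

open Classical in
/-- The number of points in row `n` which have a close successor. -/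
noncomputable def closeRowCount (t : ℝ) (J : ℕ) (x : ℝ) (n : ℕ) : ℕ :=
  ((Finset.Icc (-(J : ℤ)) (J : ℤ)).filter fun a => HasCloseSuccessor t J x (a, (n : ℤ))).card

theorem mem_latticePoints {J : ℕ} {p : ℤ × ℤ} :
    p ∈ latticePoints J ↔ (-(J : ℤ) ≤ p.1 ∧ p.1 ≤ J) ∧ 0 ≤ p.2 ∧ p.2 ≤ J := by
  simp [latticePoints]

theorem card_closePoints (t : ℝ) (J : ℕ) (x : ℝ) :
    (closePoints t J x).card = ∑ n ∈ Finset.Ico 1 J, closeRowCount t J x n := by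
  classical
  unfold closePoints closeRowCount innerPoints
  rw [Finset.card_filter, Finset.sum_product_right]
  refine Finset.sum_bij' (fun (m : ℤ) _ => m.toNat) (fun (n : ℕ) _ => (n : ℤ)) ?_ ?_ ?_ ?_ ?_
  · intro m hm; simp only [Finset.mem_Ico] at hm ⊢; omega
  · intro m hm; simp only [Finset.mem_Ico] at hm ⊢; omega
  · intro m hm; simp only [Finset.mem_Ico] at hm ⊢; omega
  · intro m hm; simp
  · intro m hm
    simp only [Finset.mem_Ico] at hm
    obtain ⟨k, rfl⟩ := Int.eq_ofNat_of_zero_le (by omega : 0 ≤ m)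
    rw [Finset.card_filter]
    rfl

theorem closeRowCount_le (t : ℝ) (J : ℕ) (x : ℝ) (n : ℕ) :
    closeRowCount t J x n ≤ 2 * J + 1 := by
  classical
  unfold closeRowCount
  refine (Finset.card_filter_le _ _).trans ?_
  rw [Int.card_Icc]; omega

/-- The left neighbour `a - 1` has offset exactly `1`, which is below the threshold in these rows.
Only `a = -J` has no left neighbour. -/
theorem le_closeRowCount {t : ℝ} {J : ℕ} {x : ℝ} {n : ℕ} (hn : 0 < n) (hnJ : n < J)
    (h : (n : ℝ) < x * t / 2 * J) : 2 * J ≤ closeRowCount t J x n := by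
  classical
  have hn0 : (0 : ℝ) < n := by exact_mod_cast hn
  have hsub : Finset.Ioc (-(J : ℤ)) (J : ℤ) ⊆
      (Finset.Icc (-(J : ℤ)) (J : ℤ)).filter fun a => HasCloseSuccessor t J x (a, (n : ℤ)) := by
    intro a ha
    rw [Finset.mem_Ioc] at ha
    rw [Finset.mem_filter, Finset.mem_Icc]
    refine ⟨⟨by omega, ha.2⟩, (a - 1, (n : ℤ)), ?_, ?_, ?_, ?_⟩
    · rw [mem_latticePoints]; dsimp only; omega
    · simp
    · simp [offset]
    · have : offset t J (a, (n : ℤ)) (a - 1, (n : ℤ)) = 1 := by simp [offset]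
      rw [this]; push_cast
      rw [lt_div_iff₀ (by positivity)]; linarith
  have := Finset.card_le_card hsub
  rw [Int.card_Ioc] at this
  unfold closeRowCount
  convert this using 1
  omega

section Row

variable {t : ℝ} {J : ℕ} {x : ℝ} {n : ℕ}

theorem add_one_le_ray (ht : 2 ≤ (t - 1) * J) (hn : 0 < n) (hnJ : n < J) {a : ℤ}
    (ha : -(J : ℤ) ≤ a) : (J : ℝ) + 1 ≤ (t * (J : ℝ) ^ 2 + a) / n := by
  have hn0 : (0 : ℝ) < n := by exact_mod_cast hn
  have hnJ' : (n : ℝ) + 1 ≤ J := by exact_mod_cast hnJ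
  have ha' : -(J : ℝ) ≤ a := by exact_mod_cast ha
  rw [le_div_iff₀ hn0]
  nlinarith

/-- A change of `k` rows moves the line of sight by `k r` with `r ≥ J + 1`. For `|k| ≥ 2` this
exceeds the width `2 J` of the rectangle, and for `k = 0` an offset in `[0, 1)` forces `q = p`. For
`k = ± 1` the only candidate is the abscissa `a + ⌊± r⌋`, whose offset is the fractional part of `±
r`. -/
theorem hasCloseSuccessor_iff (ht : 2 ≤ (t - 1) * J) (hn : 0 < n) (hnJ : n < J)
    (h : x * t / 2 * J ≤ n) {a : ℤ} (ha : -(J : ℤ) ≤ a) (ha' : a ≤ J) :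
    HasCloseSuccessor t J x (a, (n : ℤ)) ↔
      ((t * (J : ℝ) ^ 2 + a) / n + a < J + 1 ∧
        Int.fract ((t * (J : ℝ) ^ 2 + a) / n) < x * t * J / (2 * n)) ∨
      (-(J : ℝ) ≤ a - (t * (J : ℝ) ^ 2 + a) / n ∧
        Int.fract (-((t * (J : ℝ) ^ 2 + a) / n)) < x * t * J / (2 * n)) := by
  have hn0 : (0 : ℝ) < n := by exact_mod_cast hn
  have hJ0 : (0 : ℝ) < J := by exact_mod_cast hn.trans hnJ
  have hray := add_one_le_ray ht hn hnJ ha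
  set r := (t * (J : ℝ) ^ 2 + a) / n with hr
  have hθ : x * t * J / (2 * n) ≤ 1 := by
    rw [div_le_one (by positivity)]; linarith
  set θ := x * t * J / (2 * n) with hθd
  have hoff : ∀ q : ℤ × ℤ, offset t J (a, (n : ℤ)) q = ((q.2 : ℝ) - n) * r + a - q.1 := by
    intro q; simp [offset, hr]
  have haR : -(J : ℝ) ≤ a := by exact_mod_cast ha
  have haR' : (a : ℝ) ≤ J := by exact_mod_cast ha'
  constructor
  · rintro ⟨q, hq, hne, h0, h1⟩
    rw [mem_latticePoints] at hq
    have hb : -(J : ℝ) ≤ q.1 := by exact_mod_cast hq.1.1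
    have hb' : (q.1 : ℝ) ≤ J := by exact_mod_cast hq.1.2
    rw [hoff] at h0 h1
    have h1' : ((q.2 : ℝ) - n) * r + a - q.1 < θ := by simpa [hθd] using h1
    obtain ⟨k, hk⟩ : ∃ k : ℤ, q.2 = n + k := ⟨q.2 - n, by ring⟩
    have hkR : (q.2 : ℝ) - n = k := by rw [hk]; push_cast; ring
    rw [hkR] at h0 h1'
    rcases lt_trichotomy k 0 with hk0 | hk0 | hk0
    · rcases (show k ≤ -2 ∨ k = -1 by omega) with hk2 | hk2
      · have : (k : ℝ) ≤ -2 := by exact_mod_cast hk2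
        nlinarith
      · right
        subst hk2
        push_cast at h0 h1'
        have hfl : ⌊-r⌋ = q.1 - a := by
          rw [Int.floor_eq_iff]; push_cast; constructor <;> linarith
        refine ⟨by linarith, ?_⟩
        rw [← Int.self_sub_floor, hfl]; push_cast; linarith
    · subst hk0
      exfalso
      push_cast at h0 h1'
      have e1 : (0 : ℝ) ≤ ((a - q.1 : ℤ) : ℝ) := by push_cast; linarith
      have e2 : ((a - q.1 : ℤ) : ℝ) < 1 := by push_cast; linarith
      have e1' : 0 ≤ a - q.1 := by exact_mod_cast e1
      have e2' : a - q.1 < 1 := by exact_mod_cast e2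
      exact hne (Prod.ext (by dsimp only; omega) (by dsimp only; omega))
    · rcases (show 2 ≤ k ∨ k = 1 by omega) with hk2 | hk2
      · have : (2 : ℝ) ≤ k := by exact_mod_cast hk2
        nlinarith
      · left
        subst hk2
        push_cast at h0 h1'
        have hfl : ⌊r⌋ = q.1 - a := by
          rw [Int.floor_eq_iff]; push_cast; constructor <;> linarith
        refine ⟨by linarith, ?_⟩
        rw [← Int.self_sub_floor, hfl]; push_cast; linarith
  · rintro (⟨h1, h2⟩ | ⟨h1, h2⟩)
    · refine ⟨(a + ⌊r⌋, n + 1), ?_, ?_, ?_, ?_⟩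
      · rw [mem_latticePoints]; dsimp only
        have e1 : a + ⌊r⌋ < J + 1 := by
          have : ((a + ⌊r⌋ : ℤ) : ℝ) < ((J + 1 : ℤ) : ℝ) := by
            push_cast; linarith [Int.floor_le r]
          exact_mod_cast this
        have e2 : 0 ≤ ⌊r⌋ := Int.floor_nonneg.2 (by linarith)
        omega
      · intro h; have := congrArg Prod.snd h; simp at this
      · rw [hoff]; push_cast; linarith [Int.floor_le r]
      · rw [hoff]
        have := Int.self_sub_floor r
        push_cast; rw [← hθd]; linarith
    · refine ⟨(a + ⌊-r⌋, n - 1), ?_, ?_, ?_, ?_⟩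
      · rw [mem_latticePoints]; dsimp only
        have e1 : -(J : ℤ) - a ≤ ⌊-r⌋ := by
          rw [Int.le_floor]; push_cast; linarith
        have e2 : ⌊-r⌋ < 0 := Int.floor_lt.2 (by push_cast; linarith)
        omega
      · intro h; have := congrArg Prod.snd h; simp at this
      · rw [hoff]; push_cast; linarith [Int.floor_le (-r)]
      · rw [hoff]
        have := Int.self_sub_floor (-r)
        push_cast; rw [← hθd]; linarith

theorem closeRowCount_eq (ht : 2 ≤ (t - 1) * J) (hn : 2 ≤ n) (hnJ : n < J)
    (h : x * t / 2 * J ≤ n) :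
    closeRowCount t J x n =
      fractCount J n (t * (J : ℝ) ^ 2) (x * t * J / (2 * n))
        ⌈((n : ℝ) * (J + 1) - t * (J : ℝ) ^ 2) / (n + 1)⌉
      + fractCount J n (-(t * (J : ℝ) ^ 2)) (x * t * J / (2 * n))
        (⌊((n : ℝ) * J - t * (J : ℝ) ^ 2) / (n - 1)⌋ + 1) := by
  classical
  have hn0 : (0 : ℝ) < n := by exact_mod_cast (by omega : 0 < n)
  have hn1 : (0 : ℝ) < n - 1 := by
    have : (2 : ℝ) ≤ n := by exact_mod_cast hn
    linarith
  have hJ0 : (0 : ℝ) < J := by exact_mod_cast (by omega : 0 < J)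
  have hA : (J : ℝ) ≤ t * (J : ℝ) ^ 2 := by
    have : (2 : ℝ) ≤ J := by exact_mod_cast (by omega : 2 ≤ J)
    nlinarith
  set A := t * (J : ℝ) ^ 2 with hAd
  set θ := x * t * J / (2 * n) with hθd
  have e : closeRowCount t J x n
      = (((Finset.Icc (-(J : ℤ)) (J : ℤ)).filter fun a : ℤ =>
          ((A + a) / n + a < J + 1 ∧ Int.fract ((A + a) / n) < θ)) ∪
        ((Finset.Icc (-(J : ℤ)) (J : ℤ)).filter fun a : ℤ =>
          (-(J : ℝ) ≤ a - (A + a) / n ∧ Int.fract (-((A + a) / n)) < θ))).card := by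
    unfold closeRowCount
    rw [← Finset.filter_or]
    congr 1
    refine Finset.filter_congr fun a ha => ?_
    rw [Finset.mem_Icc] at ha
    exact hasCloseSuccessor_iff ht (by omega) hnJ h ha.1 ha.2
  rw [e, Finset.card_union_of_disjoint]
  · congr 1
    · unfold fractCount
      congr 1
      ext a
      simp only [Finset.mem_filter, Finset.mem_Icc, Finset.mem_Ico, Int.lt_ceil]
      have hiff : (A + a) / n + a < J + 1 ↔ (a : ℝ) < (n * (J + 1) - A) / (n + 1) := by
        rw [lt_div_iff₀ (by positivity), div_add' _ _ _ hn0.ne', div_lt_iff₀ hn0]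
        constructor <;> intro h <;> linarith
      rw [hiff]
      constructor
      · rintro ⟨⟨h1, h2⟩, h3, h4⟩; exact ⟨⟨h1, h3⟩, h4⟩
      · rintro ⟨⟨h1, h3⟩, h4⟩
        refine ⟨⟨h1, ?_⟩, h3, h4⟩
        have : (a : ℝ) < ((J + 1 : ℤ) : ℝ) := by
          refine h3.trans_le ?_
          push_cast
          rw [div_le_iff₀ (by positivity)]; nlinarith
        have : a < J + 1 := by exact_mod_cast this
        omega
    · unfold fractCount
      -- The reflection `a ↦ -a` turns the condition for the row below into the same kind of count,
      -- with `-A` in place of `A`.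
      refine Finset.card_bij (fun a _ => -a) ?_ ?_ ?_
      · intro a ha
        simp only [Finset.mem_filter, Finset.mem_Icc, Finset.mem_Ico] at ha ⊢
        obtain ⟨⟨h1, h2⟩, h3, h4⟩ := ha
        refine ⟨⟨by omega, ?_⟩, ?_⟩
        · rw [Int.lt_add_one_iff, Int.le_floor, le_div_iff₀ hn1]
          rw [le_sub_iff_add_le, ← le_sub_iff_add_le', div_le_iff₀ hn0] at h3
          push_cast; linarith
        · have : (-A + ((-a : ℤ) : ℝ)) / n = -((A + a) / n) := by push_cast; ring
          rw [this]; exact h4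
      · intro a _ b _ h; simpa using h
      · intro b hb
        simp only [Finset.mem_filter, Finset.mem_Icc, Finset.mem_Ico] at hb ⊢
        obtain ⟨⟨h1, h2⟩, h3⟩ := hb
        rw [Int.lt_add_one_iff, Int.le_floor, le_div_iff₀ hn1] at h2
        have hbJ : b ≤ J := by
          have : (b : ℝ) ≤ J := by nlinarith
          exact_mod_cast this
        refine ⟨-b, ⟨⟨by omega, by omega⟩, ?_, ?_⟩, by simp⟩
        · rw [le_sub_iff_add_le, ← le_sub_iff_add_le', div_le_iff₀ hn0]
          push_cast; linarith
        · have : -((A + ((-b : ℤ) : ℝ)) / n) = (-A + b) / n := by push_cast; ring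
          rw [this]; exact h3
  -- A successor above needs `a < J + 1 - r ≤ 0`, one below needs `a ≥ r - J ≥ 1`.
  · rw [Finset.disjoint_left]
    intro a h1 h2
    simp only [Finset.mem_filter, Finset.mem_Icc] at h1 h2
    have := add_one_le_ray ht (by omega) hnJ h1.1.1
    linarith [h1.2.1, h2.2.1]

/-- The cutoff `J - t J² / n` is what remains after replacing `n + 1` by `n`. The change is bounded
since `n` is comparable to `J`; the same holds for the row below. -/
theorem abs_ceil_sub_le {c₀ : ℝ} (hc₀ : 0 < c₀) (ht : 0 < t) (hn : 0 < n) (hnJ : n < J)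
    (h : c₀ * J ≤ n) :
    |((⌈((n : ℝ) * (J + 1) - t * (J : ℝ) ^ 2) / (n + 1)⌉ : ℤ) : ℝ) - (J - t * (J : ℝ) ^ 2 / n)|
      ≤ 2 + 2 * (t + 2) / c₀ ^ 2 := by
  have hn0 : (0 : ℝ) < n := by exact_mod_cast hn
  have hJ1 : (1 : ℝ) ≤ J := by exact_mod_cast (by omega : 1 ≤ J)
  have hnJ' : (n : ℝ) ≤ J := by exact_mod_cast hnJ.le
  set m := ((n : ℝ) * (J + 1) - t * (J : ℝ) ^ 2) / (n + 1) with hm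
  have h1 : m - (J - t * (J : ℝ) ^ 2 / n)
      = 1 + (t * (J : ℝ) ^ 2 - n * (J + 1)) / (n * (n + 1)) := by
    rw [hm]; field_simp; ring
  have h2 : |(t * (J : ℝ) ^ 2 - n * (J + 1)) / (n * (n + 1))| ≤ 2 * (t + 2) / c₀ ^ 2 := by
    rw [abs_div, abs_of_pos (by positivity : (0 : ℝ) < n * (n + 1))]
    have e1 : |t * (J : ℝ) ^ 2 - n * (J + 1)| ≤ (t + 2) * J ^ 2 := by
      rw [abs_le]; constructor <;> nlinarith [mul_pos ht (pow_pos (by linarith : (0:ℝ) < J) 2)]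
    have e2 : (c₀ * J) ^ 2 ≤ (n : ℝ) * (n + 1) := by nlinarith [mul_pos hc₀ (by linarith : (0:ℝ) < J)]
    calc _ ≤ (t + 2) * J ^ 2 / (c₀ * J) ^ 2 := by gcongr
      _ = (t + 2) / c₀ ^ 2 := by field_simp
      _ ≤ 2 * (t + 2) / c₀ ^ 2 := by gcongr; linarith
  have h3 := Int.le_ceil m
  have h4 := Int.ceil_lt_add_one m
  rw [abs_le] at h2 ⊢
  constructor <;> linarith

theorem abs_floor_sub_le {c₀ : ℝ} (hc₀ : 0 < c₀) (ht : 0 < t) (hn : 2 ≤ n) (hnJ : n < J)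
    (h : c₀ * J ≤ n) :
    |((⌊((n : ℝ) * J - t * (J : ℝ) ^ 2) / (n - 1)⌋ + 1 : ℤ) : ℝ) - (J - t * (J : ℝ) ^ 2 / n)|
      ≤ 2 + 2 * (t + 2) / c₀ ^ 2 := by
  have hn2 : (2 : ℝ) ≤ n := by exact_mod_cast hn
  have hn0 : (0 : ℝ) < n := by linarith
  have hn1 : (0 : ℝ) < n - 1 := by linarith
  have hJ1 : (1 : ℝ) ≤ J := by exact_mod_cast (by omega : 1 ≤ J)
  have hnJ' : (n : ℝ) ≤ J := by exact_mod_cast hnJ.le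
  set m := ((n : ℝ) * J - t * (J : ℝ) ^ 2) / (n - 1) with hm
  have h1 : m - (J - t * (J : ℝ) ^ 2 / n) = (n * J - t * (J : ℝ) ^ 2) / (n * (n - 1)) := by
    rw [hm]; field_simp; ring
  have h2 : |(n * J - t * (J : ℝ) ^ 2) / (n * (n - 1))| ≤ 2 * (t + 2) / c₀ ^ 2 := by
    rw [abs_div, abs_of_pos (by positivity : (0 : ℝ) < n * (n - 1))]
    have e1 : |n * J - t * (J : ℝ) ^ 2| ≤ (t + 2) * J ^ 2 := by
      rw [abs_le]; constructor <;> nlinarith [mul_pos ht (pow_pos (by linarith : (0:ℝ) < J) 2)]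
    have e2 : (c₀ * J) ^ 2 / 2 ≤ (n : ℝ) * (n - 1) := by
      nlinarith [mul_pos hc₀ (by linarith : (0:ℝ) < J)]
    have hcJ : 0 < (c₀ * J) ^ 2 / 2 := by positivity
    calc _ ≤ (t + 2) * J ^ 2 / ((c₀ * J) ^ 2 / 2) := by gcongr
      _ = 2 * (t + 2) / c₀ ^ 2 := by field_simp
  have h3 := Int.floor_le m
  have h4 := Int.lt_floor_add_one m
  rw [abs_le] at h2 ⊢
  push_cast
  constructor <;> linarith

/-- The approximation of `closeRowCount` for the rows that overlap their neighbours. -/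
noncomputable def closeRowMain (t : ℝ) (J : ℕ) (x : ℝ) (n : ℕ) : ℝ :=
  fractMain J n (t * (J : ℝ) ^ 2) (x * t * J / (2 * n)) (J - t * (J : ℝ) ^ 2 / n)
    + fractMain J n (-(t * (J : ℝ) ^ 2)) (x * t * J / (2 * n)) (J - t * (J : ℝ) ^ 2 / n)

/-- For `n < t J / 2` the smooth cutoff `J - t J² / n` lies at or to the left of `-J`, so only the
bounded rounding error is left to count. -/
theorem closeRowCount_le_of_lt (hx : 0 < x) (ht0 : 0 < t) (ht : 2 ≤ (t - 1) * J) (hn : 2 ≤ n)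
    (hnJ : n < J) (h : x * t / 2 * J ≤ n) (h' : (n : ℝ) < t / 2 * J) :
    (closeRowCount t J x n : ℝ) ≤ 2 * (2 + 2 * (t + 2) / (x * t / 2) ^ 2) := by
  have hn0 : (0 : ℝ) < n := by exact_mod_cast (by omega : 0 < n)
  have hc₀ : 0 < x * t / 2 := by positivity
  have h1 := abs_ceil_sub_le hc₀ ht0 (by omega) hnJ h
  have h2 := abs_floor_sub_le hc₀ ht0 hn hnJ h
  rw [closeRowCount_eq ht hn hnJ h]
  set C := 2 + 2 * (t + 2) / (x * t / 2) ^ 2 with hC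
  have hC0 : 0 ≤ C := by positivity
  have hX : (J : ℝ) - t * (J : ℝ) ^ 2 / n + J ≤ 0 := by
    have : 2 * (J : ℝ) ≤ t * (J : ℝ) ^ 2 / n := by
      rw [le_div_iff₀ hn0]; nlinarith
    linarith
  have b1 := (abs_le.1 h1).2
  have b2 := (abs_le.1 h2).2
  rw [two_mul C, Nat.cast_add]
  refine add_le_add (fractCount_le hC0 ?_) (fractCount_le hC0 ?_) <;> linarith

theorem abs_closeRowCount_sub_le (hx : 0 < x) (ht0 : 0 < t) (ht : 2 ≤ (t - 1) * J) (hn : 2 ≤ n)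
    (hnJ : n < J) (h : x * t / 2 * J ≤ n) (h' : t / 2 * J ≤ n) :
    |(closeRowCount t J x n : ℝ) - closeRowMain t J x n| ≤
      2 * (6 / (x * t / 2) + 2 + 5 * (2 + 2 * (t + 2) / (x * t / 2) ^ 2)) := by
  have hn1 : (1 : ℝ) ≤ n := by exact_mod_cast (by omega : 1 ≤ n)
  have hn0 : (0 : ℝ) < n := by linarith
  have hJ0 : (0 : ℝ) < J := by exact_mod_cast (by omega : 0 < J)
  have hc₀ : 0 < x * t / 2 := by positivity
  have h1 := abs_ceil_sub_le hc₀ ht0 (by omega) hnJ h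
  have h2 := abs_floor_sub_le hc₀ ht0 hn hnJ h
  rw [closeRowCount_eq ht hn hnJ h]
  set C := 2 + 2 * (t + 2) / (x * t / 2) ^ 2 with hC
  have hC0 : 0 ≤ C := by positivity
  have hA : t * (J : ℝ) ^ 2 / n ≤ 2 * J := by
    rw [div_le_iff₀ hn0]; nlinarith
  have hA0 : 0 ≤ t * (J : ℝ) ^ 2 / n := by positivity
  have hθ0 : 0 < x * t * J / (2 * n) := by positivity
  have hθ1 : x * t * J / (2 * n) ≤ 1 := by
    rw [div_le_one (by positivity)]; linarith
  have hXJ : 0 ≤ (J : ℝ) - t * (J : ℝ) ^ 2 / n + J := by linarith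
  have k1 := abs_fractCount_sub_fractMain_le (B := t * (J : ℝ) ^ 2) (by omega : 0 < n) hθ0 hθ1
    hXJ h1
  have k2 := abs_fractCount_sub_fractMain_le (B := -(t * (J : ℝ) ^ 2)) (by omega : 0 < n) hθ0 hθ1
    hXJ h2
  have k3 : ((J : ℝ) - t * (J : ℝ) ^ 2 / n + J + C) / n ≤ 2 / (x * t / 2) + C := by
    calc ((J : ℝ) - t * (J : ℝ) ^ 2 / n + J + C) / n ≤ (2 * J + C) / n := by gcongr; linarith
      _ = 2 * J / n + C / n := by ring
      _ ≤ 2 * J / (x * t / 2 * J) + C := by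
          gcongr
          exact div_le_self hC0 hn1
      _ = 2 / (x * t / 2) + C := by field_simp
  have k4 : 3 * (2 / (x * t / 2)) = 6 / (x * t / 2) := by ring
  unfold closeRowMain
  push_cast
  rw [abs_le] at k1 k2 ⊢
  constructor <;> linarith [k1.1, k1.2, k2.1, k2.2]

end Row

/-! ### Summation over the rows and the density of close points. -/

/-- The normalized sum of `bern` over the rows `n ≥ c J`, with phase `s t J² / n` up to a smooth
perturbation. -/
noncomputable def bernSum (t c s α β : ℝ) (J : ℕ) : ℝ :=
  (1 / (J : ℝ)) * ∑ n ∈ Finset.Ico ⌈c * J⌉₊ J, (n : ℝ) / J *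
    bern (s * (t * J ^ 2 / n) + (α / ((n : ℝ) / J) + β / ((n : ℝ) / J) ^ 2))

theorem tendsto_bernSum_one {t : ℝ} (ht : 0 < t) {c : ℝ} (hc0 : 0 < c) (hc1 : c ≤ 1) (α β : ℝ) :
    Tendsto (bernSum t c 1 α β) atTop (𝓝 0) := by
  have hm : ∀ y : ℝ, max y c ≠ 0 := fun y => (lt_max_of_lt_right hc0).ne'
  have hg : Continuous fun y : ℝ => α / max y c + β / (max y c) ^ 2 := by
    refine (continuous_const.div (by fun_prop) hm).add
      (continuous_const.div (by fun_prop) fun y => pow_ne_zero 2 (hm y))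
  refine (tendsto_bern_sum ht hg hc0 hc1).congr' ?_
  filter_upwards [eventually_ge_atTop 1] with J hJ
  unfold bernSum
  congr 1
  refine Finset.sum_congr rfl fun n hn => ?_
  rw [max_eq_left (natCast_div_ge_of_mem hJ hn).1, one_mul]

/-- `bern` is even, so the phase `-t J² / n` reduces to the positive one. -/
theorem tendsto_bernSum_neg_one {t : ℝ} (ht : 0 < t) {c : ℝ} (hc0 : 0 < c) (hc1 : c ≤ 1)
    (α β : ℝ) : Tendsto (bernSum t c (-1) α β) atTop (𝓝 0) := by
  refine (tendsto_bernSum_one ht hc0 hc1 (-α) (-β)).congr fun J => ?_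
  unfold bernSum
  congr 1
  refine Finset.sum_congr rfl fun n _ => ?_
  rw [← bern_neg]
  congr 2
  ring

theorem sum_closeRowMain {t x c : ℝ} (hc0 : 0 < c) {J : ℕ} (hJ : 0 < J) :
    (1 / (J : ℝ) ^ 2) * ∑ n ∈ Finset.Ico ⌈c * J⌉₊ J, closeRowMain t J x n
      = (1 / (J : ℝ)) * ∑ n ∈ Finset.Ico ⌈c * J⌉₊ J,
          x * t * (2 / max ((n : ℝ) / J) c - t / (max ((n : ℝ) / J) c) ^ 2)
        + 1 / 2 * (((bernSum t c 1 (1 - x * t / 2) (-t) J - bernSum t c 1 (-1 - x * t / 2) 0 J)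
            - (bernSum t c 1 1 (-t) J - bernSum t c 1 (-1) 0 J))
          + ((bernSum t c (-1) (1 - x * t / 2) (-t) J - bernSum t c (-1) (-1 - x * t / 2) 0 J)
            - (bernSum t c (-1) 1 (-t) J - bernSum t c (-1) (-1) 0 J))) := by
  have hJ0 : (0 : ℝ) < J := by exact_mod_cast hJ
  unfold bernSum
  simp only [← mul_sub, ← mul_add, ← Finset.sum_sub_distrib, ← Finset.sum_add_distrib]
  rw [mul_left_comm (1 / 2 : ℝ), ← mul_add,
    show (1 : ℝ) / (J : ℝ) ^ 2 = 1 / J * (1 / J) by field_simp, mul_assoc]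
  congr 1
  rw [Finset.mul_sum, Finset.mul_sum, ← Finset.sum_add_distrib]
  refine Finset.sum_congr rfl fun n hn => ?_
  have hy := (natCast_div_ge_of_mem hJ hn).1
  rw [max_eq_left hy]
  have hn0 : (0 : ℝ) < n := by
    have : 0 < (n : ℝ) / J := hc0.trans_le hy
    by_contra h
    have : (n : ℝ) / J ≤ 0 := div_nonpos_of_nonpos_of_nonneg (not_lt.1 h) hJ0.le
    linarith
  -- With `y = n / J`, the terms `J / n`, `x t J / (2 n)` and `t J² / n²` become `1 / y`, `(x t / 2)
  -- / y` and `t / y²`; `s = ± 1` distinguishes the rows above and below.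
  have a1 : ∀ s : ℝ, (s * (t * (J : ℝ) ^ 2) + (J - t * (J : ℝ) ^ 2 / n)) / n - x * t * J / (2 * n)
      = s * (t * J ^ 2 / n) + ((1 - x * t / 2) / ((n : ℝ) / J) + (-t) / ((n : ℝ) / J) ^ 2) := by
    intro s; field_simp; ring
  have a2 : ∀ s : ℝ, (s * (t * (J : ℝ) ^ 2) - J) / n - x * t * J / (2 * n)
      = s * (t * J ^ 2 / n) + ((-1 - x * t / 2) / ((n : ℝ) / J) + 0 / ((n : ℝ) / J) ^ 2) := by
    intro s; field_simp; ring
  have a3 : ∀ s : ℝ, (s * (t * (J : ℝ) ^ 2) + (J - t * (J : ℝ) ^ 2 / n)) / n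
      = s * (t * J ^ 2 / n) + (1 / ((n : ℝ) / J) + (-t) / ((n : ℝ) / J) ^ 2) := by
    intro s; field_simp; ring
  have a4 : ∀ s : ℝ, (s * (t * (J : ℝ) ^ 2) - J) / n
      = s * (t * J ^ 2 / n) + ((-1) / ((n : ℝ) / J) + 0 / ((n : ℝ) / J) ^ 2) := by
    intro s; field_simp; ring
  rw [← a1 1, ← a1 (-1), ← a2 1, ← a2 (-1), ← a3 1, ← a3 (-1), ← a4 1, ← a4 (-1)]
  simp only [one_mul, neg_one_mul]
  unfold closeRowMain fractMain
  generalize bern _ = u₁, bern _ = u₂, bern _ = u₃, bern _ = u₄, bern _ = u₅, bern _ = u₆,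
    bern _ = u₇, bern _ = u₈
  field_simp
  ring

theorem integral_overlap {t x c : ℝ} (hc0 : 0 < c) (hc1 : c ≤ 1) :
    ∫ y in c..1, x * t * (2 / max y c - t / (max y c) ^ 2)
      = x * t * (-2 * Real.log c - t * (1 / c - 1)) := by
  have hpos : ∀ y ∈ Set.uIcc c 1, 0 < y := fun y hy => by
    rw [Set.uIcc_of_le hc1] at hy; exact hc0.trans_le hy.1
  have h1 : ∫ y in c..1, x * t * (2 / max y c - t / (max y c) ^ 2)
      = ∫ y in c..1, x * t * (2 / y - t / y ^ 2) := by
    refine intervalIntegral.integral_congr fun y hy => ?_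
    rw [Set.uIcc_of_le hc1] at hy
    simp only [max_eq_left hy.1]
  rw [h1, intervalIntegral.integral_eq_sub_of_hasDerivAt
    (f := fun y => x * t * (2 * Real.log y + t * y⁻¹))]
  · simp only [Real.log_one]
    ring
  · intro y hy
    have hy0 := (hpos y hy).ne'
    have : HasDerivAt (fun y => x * t * (2 * Real.log y + t * y⁻¹)) _ y :=
      (((Real.hasDerivAt_log hy0).const_mul 2).add
      ((hasDerivAt_inv hy0).const_mul t)).const_mul (x * t)
    exact this.congr_deriv (by ring)
  · refine ContinuousOn.intervalIntegrable fun y hy => ?_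
    have hy0 := (hpos y hy).ne'
    refine ContinuousAt.continuousWithinAt ?_
    fun_prop (disch := positivity)

/-- The left end of the range of relative heights `n / J` for which neighbouring rows overlap. -/
noncomputable def overlapStart (t x : ℝ) : ℝ := min 1 (max (t / 2) (x * t / 2))

/-- The limit of `J⁻²` times the number of points having a close successor. -/
noncomputable def closeDensity (t x : ℝ) : ℝ :=
  x * t * (1 - 2 * Real.log (overlapStart t x) - t * (1 / overlapStart t x - 1))

/-- Three ranges of rows: below `x t J / 2` all but at most one point per row is close, up to the
overlap range boundedly many are, and above it `closeRowMain` is correct up to a bounded error. Over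
at most `J` rows this is `O(J)`. -/
theorem abs_card_closePoints_sub_le {t x : ℝ} (ht : 1 < t) (hx : 0 < x) (hxt : x * t / 2 < 1) :
    ∃ C : ℝ, ∀ᶠ J : ℕ in atTop, |((closePoints t J x).card : ℝ)
      - (2 * J * ((⌈x * t / 2 * J⌉₊ : ℝ) - 1)
        + ∑ n ∈ Finset.Ico ⌈overlapStart t x * J⌉₊ J, closeRowMain t J x n)| ≤ C * J := by
  have ht0 : 0 < t := by linarith
  set c₀ := x * t / 2 with hc₀d
  have hc₀ : 0 < c₀ := by positivity
  set c := overlapStart t x with hcd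
  have hc₀c : c₀ ≤ c := le_min hxt.le (le_max_right _ _)
  have hc1 : c ≤ 1 := min_le_left _ _
  set C₁ := 2 * (2 + 2 * (t + 2) / c₀ ^ 2) with hC₁
  set C₂ := 2 * (6 / c₀ + 2 + 5 * (2 + 2 * (t + 2) / c₀ ^ 2)) with hC₂
  have hC₁0 : 0 ≤ C₁ := by positivity
  have hC₂0 : 0 ≤ C₂ := by positivity
  refine ⟨1 + C₁ + C₂, ?_⟩
  have e1 : ∀ᶠ J : ℕ in atTop, 2 ≤ (t - 1) * (J : ℝ) :=
    (tendsto_natCast_atTop_atTop.const_mul_atTop (by linarith)).eventually_ge_atTop 2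
  -- This makes `n ≥ 2` in all rows `n ≥ c₀ J`, as the denominator `n - 1` of the lower cutoff
  -- requires.
  have e2 : ∀ᶠ J : ℕ in atTop, 2 ≤ c₀ * (J : ℝ) :=
    (tendsto_natCast_atTop_atTop.const_mul_atTop hc₀).eventually_ge_atTop 2
  filter_upwards [e1, e2, eventually_ge_atTop 1] with J h1 h2 hJ
  have hJ0 : (0 : ℝ) < J := by exact_mod_cast hJ
  set m₀ := ⌈c₀ * J⌉₊ with hm₀
  set m₁ := ⌈c * J⌉₊ with hm₁
  have h1m : 1 ≤ m₀ := Nat.one_le_ceil_iff.2 (by positivity)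
  have hm01 : m₀ ≤ m₁ := Nat.ceil_le_ceil (by gcongr)
  have hm1J : m₁ ≤ J := Nat.ceil_le.2 (by nlinarith)
  have hcard : ((closePoints t J x).card : ℝ) = ∑ n ∈ Finset.Ico 1 m₀, (closeRowCount t J x n : ℝ)
      + ∑ n ∈ Finset.Ico m₀ m₁, (closeRowCount t J x n : ℝ)
      + ∑ n ∈ Finset.Ico m₁ J, (closeRowCount t J x n : ℝ) := by
    rw [card_closePoints, Finset.sum_Ico_consecutive _ h1m hm01,
      Finset.sum_Ico_consecutive _ (h1m.trans hm01) hm1J]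
    push_cast; rfl
  have s1 : |∑ n ∈ Finset.Ico 1 m₀, (closeRowCount t J x n : ℝ) - 2 * J * ((m₀ : ℝ) - 1)|
      ≤ J * 1 := by
    have : 2 * J * ((m₀ : ℝ) - 1) = ∑ n ∈ Finset.Ico 1 m₀, (2 * J : ℝ) := by
      rw [Finset.sum_const, Nat.card_Ico, nsmul_eq_mul, Nat.cast_sub h1m]; push_cast; ring
    rw [this, ← Finset.sum_sub_distrib]
    refine (Finset.abs_sum_le_sum_abs _ _).trans
      ((Finset.sum_le_card_nsmul _ _ 1 fun n hn => ?_).trans ?_)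
    · rw [Finset.mem_Ico] at hn
      have hlt : (n : ℝ) < c₀ * J := Nat.lt_ceil.1 hn.2
      have a1 := le_closeRowCount (t := t) (x := x) (by omega : 0 < n) (by omega : n < J) hlt
      have a2 := closeRowCount_le t J x n
      have a1' : (2 * J : ℝ) ≤ closeRowCount t J x n := by exact_mod_cast a1
      have a2' : (closeRowCount t J x n : ℝ) ≤ 2 * J + 1 := by exact_mod_cast a2
      rw [abs_le]; constructor <;> linarith
    · rw [nsmul_eq_mul, Nat.card_Ico]
      gcongr
      omega
  have s2 : |∑ n ∈ Finset.Ico m₀ m₁, (closeRowCount t J x n : ℝ)| ≤ J * C₁ := by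
    refine (Finset.abs_sum_le_sum_abs _ _).trans
      ((Finset.sum_le_card_nsmul _ _ C₁ fun n hn => ?_).trans ?_)
    · rw [Finset.mem_Ico] at hn
      have hge : c₀ * J ≤ n := Nat.ceil_le.1 hn.1
      have hn2 : 2 ≤ n := by
        have : (2 : ℝ) ≤ n := by linarith
        exact_mod_cast this
      have hlt : (n : ℝ) < c * J := Nat.lt_ceil.1 hn.2
      have hlt' : (n : ℝ) < t / 2 * J := by
        have h3 : c * J ≤ max (t / 2) c₀ * J := by gcongr; exact min_le_right _ _
        rcases max_choice (t / 2) c₀ with h | h <;> rw [h] at h3 <;> linarith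
      rw [abs_of_nonneg (Nat.cast_nonneg _)]
      exact closeRowCount_le_of_lt hx ht0 h1 hn2 (by omega) hge hlt'
    · rw [nsmul_eq_mul, Nat.card_Ico]
      gcongr
      omega
  have s3 : |∑ n ∈ Finset.Ico m₁ J, (closeRowCount t J x n : ℝ)
      - ∑ n ∈ Finset.Ico m₁ J, closeRowMain t J x n| ≤ J * C₂ := by
    rw [← Finset.sum_sub_distrib]
    refine (Finset.abs_sum_le_sum_abs _ _).trans
      ((Finset.sum_le_card_nsmul _ _ C₂ fun n hn => ?_).trans ?_)
    · rw [Finset.mem_Ico] at hn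
      have hge' : c * J ≤ n := Nat.ceil_le.1 hn.1
      have hge : c₀ * J ≤ n := le_trans (by gcongr) hge'
      have hn2 : 2 ≤ n := by
        have : (2 : ℝ) ≤ n := by linarith
        exact_mod_cast this
      have hnJ : (n : ℝ) < J := by exact_mod_cast hn.2
      -- If the cap at `1` is active, the range `n ≥ c J`, `n < J` is empty.
      have hcm : max (t / 2) c₀ ≤ c := by
        rcases min_choice 1 (max (t / 2) c₀) with h | h
        · exfalso
          have : c = 1 := h
          rw [this] at hge'; linarith
        · exact h.ge
      have hge2 : t / 2 * J ≤ n := by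
        have : t / 2 * J ≤ c * J := by gcongr; exact (le_max_left _ _).trans hcm
        linarith
      exact abs_closeRowCount_sub_le hx ht0 h1 hn2 hn.2 hge hge2
    · rw [nsmul_eq_mul, Nat.card_Ico]
      gcongr
      omega
  rw [hcard]
  rw [abs_le] at s1 s2 s3 ⊢
  constructor <;> linarith [s1.1, s1.2, s2.1, s2.2, s3.1, s3.2]

/-- After division by `J²` the mean parts of the rows form a Riemann sum for the overlap integral,
and all eight Bernoulli averages vanish in the limit. -/
theorem tendsto_card_closePoints {t x : ℝ} (ht : 1 < t) (hx : 0 < x) (hxt : x * t / 2 < 1) :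
    Tendsto (fun J : ℕ => ((closePoints t J x).card : ℝ) / (J : ℝ) ^ 2) atTop
      (𝓝 (closeDensity t x)) := by
  have ht0 : 0 < t := by linarith
  obtain ⟨C, hC⟩ := abs_card_closePoints_sub_le ht hx hxt
  set c := overlapStart t x with hcd
  have hc₀ : 0 < x * t / 2 := by positivity
  have hc0 : 0 < c := lt_min one_pos (lt_max_of_lt_right hc₀)
  have hc1 : c ≤ 1 := min_le_left _ _
  have hone : Tendsto (fun J : ℕ => 1 / (J : ℝ)) atTop (𝓝 0) := tendsto_one_div_atTop_nhds_zero_nat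
  have hm : ∀ y : ℝ, max y c ≠ 0 := fun y => (lt_max_of_lt_right hc0).ne'
  have hF : Continuous fun y : ℝ => x * t * (2 / max y c - t / (max y c) ^ 2) :=
    continuous_const.mul ((continuous_const.div (by fun_prop) hm).sub
      (continuous_const.div (by fun_prop) fun y => pow_ne_zero 2 (hm y)))
  have hR := tendsto_riemann_sum hF hc0.le hc1
  rw [integral_overlap hc0 hc1] at hR
  have b1 := tendsto_bernSum_one ht0 hc0 hc1
  have b2 := tendsto_bernSum_neg_one ht0 hc0 hc1
  have hB := ((((b1 (1 - x * t / 2) (-t)).sub (b1 (-1 - x * t / 2) 0)).sub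
    ((b1 1 (-t)).sub (b1 (-1) 0))).add (((b2 (1 - x * t / 2) (-t)).sub
    (b2 (-1 - x * t / 2) 0)).sub ((b2 1 (-t)).sub (b2 (-1) 0)))).const_mul (1 / 2)
  have hceil : Tendsto (fun J : ℕ => 2 * ((⌈x * t / 2 * J⌉₊ : ℝ) / J - 1 / J)) atTop
      (𝓝 (2 * (x * t / 2 - 0))) :=
    (((tendsto_nat_ceil_mul_div_atTop hc₀.le).comp tendsto_natCast_atTop_atTop).sub hone).const_mul 2
  have hmain := hceil.add (hR.add hB)
  have hlim : 2 * (x * t / 2 - 0) + (x * t * (-2 * Real.log c - t * (1 / c - 1))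
      + 1 / 2 * (0 - 0 - (0 - 0) + (0 - 0 - (0 - 0)))) = closeDensity t x := by
    unfold closeDensity; rw [← hcd]; ring
  rw [hlim] at hmain
  refine tendsto_of_tendsto_of_dist hmain ?_
  have hCJ : Tendsto (fun J : ℕ => C * (1 / (J : ℝ))) atTop (𝓝 0) := by
    simpa using hone.const_mul C
  refine squeeze_zero' (Eventually.of_forall fun _ => dist_nonneg) ?_ hCJ
  filter_upwards [hC, eventually_ge_atTop 1] with J h1 hJ
  have hJ0 : (0 : ℝ) < J := by exact_mod_cast hJ
  rw [← sum_closeRowMain hc0 hJ, dist_comm, Real.dist_eq]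
  have : ((closePoints t J x).card : ℝ) / (J : ℝ) ^ 2
      - (2 * ((⌈x * t / 2 * J⌉₊ : ℝ) / J - 1 / J)
        + 1 / (J : ℝ) ^ 2 * ∑ n ∈ Finset.Ico ⌈c * J⌉₊ J, closeRowMain t J x n)
      = (((closePoints t J x).card : ℝ) - (2 * J * ((⌈x * t / 2 * J⌉₊ : ℝ) - 1)
        + ∑ n ∈ Finset.Ico ⌈c * J⌉₊ J, closeRowMain t J x n)) / (J : ℝ) ^ 2 := by
    field_simp
  rw [this, abs_div, abs_of_pos (by positivity : (0 : ℝ) < (J : ℝ) ^ 2)]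
  calc _ ≤ C * J / (J : ℝ) ^ 2 := by gcongr
    _ = C * (1 / J) := by field_simp

/-! ### View angles and their ordered list. -/

theorem arctan_sub_arctan_le {u v : ℝ} (huv : u ≤ v) : Real.arctan v - Real.arctan u ≤ v - u := by
  have hmono : Monotone fun y : ℝ => y - Real.arctan y := by
    refine monotone_of_hasDerivAt_nonneg (f' := fun y => 1 - 1 / (1 + y ^ 2))
      (fun y => (hasDerivAt_id y).sub (Real.hasDerivAt_arctan y)) fun y => ?_
    have : 1 / (1 + y ^ 2) ≤ 1 := by
      rw [div_le_one (by positivity)]; nlinarith [sq_nonneg y]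
    simpa using this
  have := hmono huv
  simp only at this
  linarith

theorem sub_le_mul_arctan_sub_arctan {u v T : ℝ} (hu : 0 ≤ u) (huv : u ≤ v) (hv : v ≤ T) :
    v - u ≤ (1 + T ^ 2) * (Real.arctan v - Real.arctan u) := by
  have hmono : MonotoneOn (fun y : ℝ => (1 + T ^ 2) * Real.arctan y - y) (Set.Icc 0 T) := by
    refine monotoneOn_of_deriv_nonneg (convex_Icc 0 T) (by fun_prop)
      ((Real.differentiable_arctan.const_mul _).sub differentiable_id).differentiableOn
      fun y hy => ?_
    rw [interior_Icc] at hy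
    have hd : HasDerivAt (fun y : ℝ => (1 + T ^ 2) * Real.arctan y - y)
        ((1 + T ^ 2) * (1 / (1 + y ^ 2)) - 1) y :=
      ((Real.hasDerivAt_arctan y).const_mul _).sub (hasDerivAt_id y)
    rw [hd.deriv, sub_nonneg, mul_one_div, le_div_iff₀ (by positivity)]
    nlinarith [hy.1, hy.2]
  have := hmono ⟨hu, huv.trans hv⟩ ⟨hu.trans huv, hv⟩ huv
  simp only at this
  linarith

theorem viewAngle_eq_arctan {t : ℝ} {J : ℕ} {p : ℤ × ℤ} (hA : 0 < t * (J : ℝ) ^ 2)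
    (hp : 0 < t * (J : ℝ) ^ 2 + p.1) (hp2 : 0 ≤ p.2) :
    viewAngle t J p = Real.arctan (p.2 / (t * (J : ℝ) ^ 2 + p.1)) := by
  unfold viewAngle EuclideanGeometry.angle
  set A := t * (J : ℝ) ^ 2 with hAd
  set v : EuclideanSpace ℝ (Fin 2) := !₂[A + p.1, 0] with hv
  set w : EuclideanSpace ℝ (Fin 2) := !₂[0, (p.2 : ℝ)] with hw
  -- The vector to `p` is split into a horizontal part `v` and a vertical part `w`; the origin is
  -- seen in the direction of `v`.
  have h1 : (toPlane p -ᵥ observer t J : EuclideanSpace ℝ (Fin 2)) = v + w := by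
    ext i
    fin_cases i <;> simp [toPlane, observer, hv, hw, hAd, add_comm]
  have h2 : ((0 : EuclideanSpace ℝ (Fin 2)) -ᵥ observer t J) = (A / (A + p.1)) • v := by
    ext i
    fin_cases i
    · simp [observer, hv, ← hAd, div_mul_cancel₀ _ hp.ne']
    · simp [observer, hv]
  rw [h1, h2, InnerProductGeometry.angle_smul_right_of_pos _ _ (by positivity),
    InnerProductGeometry.angle_comm, InnerProductGeometry.angle_add_eq_arctan_of_inner_eq_zero]
  · congr 1
    have hp2' : (0 : ℝ) ≤ p.2 := by exact_mod_cast hp2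
    simp [EuclideanSpace.norm_eq, Fin.sum_univ_two, hv, hw, Real.sqrt_sq_eq_abs, abs_of_pos hp,
      abs_of_nonneg hp2']
  · simp [PiLp.inner_apply, Fin.sum_univ_two, hv, hw]
  · intro h
    have := congrFun (congrArg (fun u : EuclideanSpace ℝ (Fin 2) => u.ofLp) h) 0
    simp [hv] at this
    linarith

/-- A positive gap occurs at the last index carrying a given value, so large gaps inject into the
distinct values whose next larger value is far away. In the converse bound the largest value
qualifies vacuously, whence the extra `1` there. -/
theorem card_gaps_le {f : ℕ → ℝ} {N : ℕ} {δ : ℝ} (hδ : 0 < δ)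
    (hf : ∀ i j, 1 ≤ i → i ≤ j → j ≤ N → f i ≤ f j) (V : Finset ℝ)
    (hV : ∀ v, v ∈ V ↔ ∃ j, 1 ≤ j ∧ j ≤ N ∧ f j = v) :
    ((Finset.Ico 1 N).filter fun j => δ ≤ f (j + 1) - f j).card
      ≤ (V.filter fun v => ∀ w ∈ V, v < w → v + δ ≤ w).card := by
  have hlt : ∀ i j, 1 ≤ i → i < j → j ≤ N → δ ≤ f (i + 1) - f i → f i < f j := by
    intro i j h1 h2 h3 h4
    have := hf (i + 1) j (by omega) h2 h3
    linarith
  refine Finset.card_le_card_of_injOn f ?_ ?_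
  · intro j hj
    rw [Finset.mem_coe, Finset.mem_filter, Finset.mem_Ico] at hj
    rw [Finset.mem_coe, Finset.mem_filter]
    refine ⟨(hV _).2 ⟨j, hj.1.1, hj.1.2.le, rfl⟩, fun w hw hlw => ?_⟩
    obtain ⟨i, hi1, hi2, rfl⟩ := (hV w).1 hw
    have hij : j < i := by
      by_contra h
      exact absurd (hf i j hi1 (not_lt.1 h) hj.1.2.le) (not_le.2 hlw)
    have := hf (j + 1) i (by omega) hij hi2
    linarith [hj.2]
  · intro i hi j hj hij
    simp only [Finset.coe_filter, Finset.mem_Ico, Set.mem_ofPred_eq] at hi hj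
    rcases lt_trichotomy i j with h | h | h
    · exact absurd hij (hlt i j hi.1.1 h hj.1.2.le hi.2).ne
    · exact h
    · exact absurd hij (hlt j i hj.1.1 h hi.1.2.le hj.2).ne'

theorem le_card_gaps_add_one {f : ℕ → ℝ} {N : ℕ} {δ : ℝ} (V : Finset ℝ)
    (hf : ∀ i j, 1 ≤ i → i ≤ j → j ≤ N → f i ≤ f j)
    (hV : ∀ v, v ∈ V ↔ ∃ j, 1 ≤ j ∧ j ≤ N ∧ f j = v) :
    (V.filter fun v => ∀ w ∈ V, v < w → v + δ ≤ w).card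
      ≤ ((Finset.Ico 1 N).filter fun j => δ ≤ f (j + 1) - f j).card + 1 := by
  classical
  have hsub : (V.filter fun v => ∀ w ∈ V, v < w → v + δ ≤ w) ⊆
      insert (f N) (((Finset.Ico 1 N).filter fun j => δ ≤ f (j + 1) - f j).image f) := by
    intro v hv
    rw [Finset.mem_filter] at hv
    rw [Finset.mem_insert, or_iff_not_imp_left]
    intro hne
    obtain ⟨j₀, hj₀⟩ := (hV v).1 hv.1
    -- The last index with value `v` is the one followed by a strictly larger value.
    set j := Nat.findGreatest (fun j => 1 ≤ j ∧ f j = v) N with hj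
    have hspec : 1 ≤ j ∧ f j = v :=
      Nat.findGreatest_spec (P := fun j => 1 ≤ j ∧ f j = v) hj₀.2.1 ⟨hj₀.1, hj₀.2.2⟩
    have hjN : j ≤ N := Nat.findGreatest_le N
    have hjN' : j < N := by
      rcases hjN.eq_or_lt with h | h
      · exact absurd (by rw [← h]; exact hspec.2.symm) hne
      · exact h
    have hsucc : f (j + 1) ≠ v := fun h =>
      absurd (Nat.le_findGreatest (P := fun j => 1 ≤ j ∧ f j = v) hjN' ⟨by omega, h⟩)
        (by rw [← hj]; omega)
    have hle : v ≤ f (j + 1) := hspec.2 ▸ hf j (j + 1) hspec.1 (by omega) hjN'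
    have := hv.2 (f (j + 1)) ((hV _).2 ⟨j + 1, by omega, hjN', rfl⟩)
      (lt_of_le_of_ne hle (Ne.symm hsucc))
    rw [Finset.mem_image]
    refine ⟨j, ?_, hspec.2⟩
    rw [Finset.mem_filter, Finset.mem_Ico, hspec.2]
    exact ⟨⟨hspec.1, hjN'⟩, by linarith⟩
  exact (Finset.card_le_card hsub).trans ((Finset.card_insert_le _ _).trans
    (Nat.add_le_add_right Finset.card_image_le 1))

theorem length_sortedAngles (t : ℝ) (J : ℕ) : (sortedAngles t J).length = numPoints J := by
  simp [sortedAngles, numPoints]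

theorem orderedAngle_eq_getElem {t : ℝ} {J j : ℕ} (h : j - 1 < (sortedAngles t J).length) :
    orderedAngle t J j = (sortedAngles t J)[j - 1] := by
  unfold orderedAngle
  rw [List.getD_eq_getElem _ _ h]

theorem orderedAngle_mono {t : ℝ} {J i j : ℕ} (hi : 1 ≤ i) (hij : i ≤ j) (hj : j ≤ numPoints J) :
    orderedAngle t J i ≤ orderedAngle t J j := by
  have hl := length_sortedAngles t J
  rw [orderedAngle_eq_getElem (by omega), orderedAngle_eq_getElem (by omega)]
  have hs : (sortedAngles t J).SortedLE := by
    unfold sortedAngles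
    exact (Multiset.pairwise_sort _ _).sortedLE
  exact hs.getElem_le_getElem_of_le (by omega)

theorem mem_image_viewAngle_iff {t : ℝ} {J : ℕ} (v : ℝ) :
    v ∈ (latticePoints J).image (viewAngle t J) ↔
      ∃ j, 1 ≤ j ∧ j ≤ numPoints J ∧ orderedAngle t J j = v := by
  have hl := length_sortedAngles t J
  have h1 : v ∈ (latticePoints J).image (viewAngle t J) ↔ v ∈ sortedAngles t J := by
    simp [sortedAngles]
  rw [h1, List.mem_iff_getElem]
  constructor
  · rintro ⟨i, hi, rfl⟩
    refine ⟨i + 1, by omega, by omega, ?_⟩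
    rw [orderedAngle_eq_getElem (by simpa using hi)]
    simp
  · rintro ⟨j, h1, h2, rfl⟩
    refine ⟨j - 1, by omega, ?_⟩
    rw [orderedAngle_eq_getElem (by omega)]

theorem numPoints_eq (J : ℕ) : numPoints J = (2 * J + 1) * (J + 1) := by
  unfold numPoints latticePoints
  rw [Finset.card_product, Int.card_Icc, Int.card_Icc]
  congr 1
  omega

theorem card_innerPoints {J : ℕ} (hJ : 1 ≤ J) :
    (innerPoints J).card + 2 * (2 * J + 1) = numPoints J := by
  unfold innerPoints
  rw [numPoints_eq, Finset.card_product, Int.card_Icc, Int.card_Ico]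
  obtain ⟨k, rfl⟩ : ∃ k, J = k + 1 := ⟨J - 1, by omega⟩
  have h1 : (((k + 1 : ℕ) : ℤ) + 1 - -((k + 1 : ℕ) : ℤ)).toNat = 2 * k + 3 := by omega
  have h2 : (((k + 1 : ℕ) : ℤ) - 1).toNat = k := by omega
  rw [h1, h2]; ring

theorem averageAngle_eq {t : ℝ} {J : ℕ} (hJ : 1 ≤ J) (htJ : (J : ℝ) < t * (J : ℝ) ^ 2) :
    averageAngle t J = Real.arctan (J / (t * (J : ℝ) ^ 2 - J)) / numPoints J := by
  unfold averageAngle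
  congr 1
  have hJ0 : (0 : ℝ) < J := by exact_mod_cast hJ
  have hN : 1 ≤ numPoints J := by rw [numPoints_eq]; exact Nat.mul_pos (by omega) (by omega)
  have hview : ∀ p ∈ latticePoints J,
      viewAngle t J p = Real.arctan (p.2 / (t * (J : ℝ) ^ 2 + p.1)) := by
    intro p hp
    rw [mem_latticePoints] at hp
    have : -(J : ℝ) ≤ p.1 := by exact_mod_cast hp.1.1
    exact viewAngle_eq_arctan (by linarith) (by linarith) hp.2.1
  apply le_antisymm
  · obtain ⟨p, hp, hpv⟩ := Finset.mem_image.1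
      ((mem_image_viewAngle_iff (t := t) _).2 ⟨numPoints J, hN, le_rfl, rfl⟩)
    rw [← hpv, hview p hp]
    rw [mem_latticePoints] at hp
    have h1 : -(J : ℝ) ≤ p.1 := by exact_mod_cast hp.1.1
    have h2 : (p.2 : ℝ) ≤ J := by exact_mod_cast hp.2.2
    refine Real.arctan_mono (div_le_div₀ hJ0.le h2 (by linarith) (by linarith))
  -- The largest angle belongs to the corner `(-J, J)`, nearest to the observer in the top row.
  · have hmem : (-(J : ℤ), (J : ℤ)) ∈ latticePoints J := by
      rw [mem_latticePoints]; dsimp only; omega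
    obtain ⟨j, hj1, hj2, hj3⟩ := (mem_image_viewAngle_iff (t := t) _).1
      (Finset.mem_image_of_mem (viewAngle t J) hmem)
    have h := orderedAngle_mono (t := t) hj1 hj2 le_rfl
    rw [hj3, hview _ hmem] at h
    simpa [sub_eq_add_neg] using h

/-! ### Comparison of angle differences with offsets. -/

theorem tendsto_comp_one_div {φ : ℝ → ℝ} {l : ℝ} (hφ : ContinuousAt φ 0) (h0 : φ 0 = l) :
    Tendsto (fun J : ℕ => φ (1 / (J : ℝ))) atTop (𝓝 l) := by
  rw [← h0]
  exact hφ.tendsto.comp tendsto_one_div_atTop_nhds_zero_nat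

/-- Here `J / (t J² - J) ∼ 1 / (t J)`, `N_J ∼ 2 J²` and the squared distance is `∼ t² J⁴`, so the
left side is `∼ x t J / 2`. The slack `x < x'` absorbs the error; the lower bound works the same
way. -/
theorem eventually_average_upper {t x x' : ℝ} (ht : 1 < t) (hxx : x < x') :
    ∀ᶠ J : ℕ in atTop, (1 + ((J : ℝ) / (t * (J : ℝ) ^ 2 - J)) ^ 2) *
      (x * ((J / (t * (J : ℝ) ^ 2 - J)) / numPoints J)) * (t * (J : ℝ) ^ 2 + J) ^ 2
        ≤ x' * t * J / 2 := by
  have hlim := tendsto_comp_one_div (l := t / 2)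
    (φ := fun s => (1 + (s / (t - s)) ^ 2) * (1 / (t - s)) * (t + s) ^ 2 / ((2 + s) * (1 + s)))
    (by
      have h1 : t - 0 ≠ 0 := by linarith
      fun_prop (disch := first | exact h1 | norm_num)) (by
      have h1 : t ≠ 0 := by positivity
      field_simp; norm_num; ring)
  have h2 := hlim.const_mul x
  have ht0 : 0 < t := by linarith
  filter_upwards [h2.eventually_lt_const (show x * (t / 2) < x' * (t / 2) by gcongr),
    eventually_ge_atTop 1] with J h hJ
  have hJ1 : (1 : ℝ) ≤ J := by exact_mod_cast hJ
  have hJ0 : (0 : ℝ) < J := by linarith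
  have htJ : 0 < t * J - 1 := by nlinarith
  have hid : (1 + ((J : ℝ) / (t * (J : ℝ) ^ 2 - J)) ^ 2) *
      (x * ((J / (t * (J : ℝ) ^ 2 - J)) / numPoints J)) * (t * (J : ℝ) ^ 2 + J) ^ 2
      = J * (x * ((1 + (1 / (J : ℝ) / (t - 1 / J)) ^ 2) * (1 / (t - 1 / J)) * (t + 1 / J) ^ 2
        / ((2 + 1 / J) * (1 + 1 / J)))) := by
    rw [numPoints_eq]
    push_cast
    have e1 : t * (J : ℝ) ^ 2 - J = J * (t * J - 1) := by ring
    have e2 : t - 1 / (J : ℝ) = (t * J - 1) / J := by field_simp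
    rw [e1, e2]
    field_simp
  rw [hid]
  have := mul_le_mul_of_nonneg_left h.le hJ0.le
  linarith

theorem eventually_average_lower {t x x' : ℝ} (ht : 1 < t) (hxx : x' < x) :
    ∀ᶠ J : ℕ in atTop, x' * t * J / 2 * (1 + ((J : ℝ) / (t * (J : ℝ) ^ 2 - J)) ^ 2)
      ≤ x * ((J / (t * (J : ℝ) ^ 2 - J)) / numPoints J) * (t * (J : ℝ) ^ 2 - J) ^ 2 := by
  have hl1 := tendsto_comp_one_div (l := t / 2)
    (φ := fun s => (1 / (t - s)) * (t - s) ^ 2 / ((2 + s) * (1 + s)))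
    (by
      have h1 : t - 0 ≠ 0 := by linarith
      fun_prop (disch := first | exact h1 | norm_num)) (by
      have h1 : t ≠ 0 := by positivity
      field_simp; norm_num)
  have hl2 := tendsto_comp_one_div (l := 1) (φ := fun s => 1 + (s / (t - s)) ^ 2)
    (by
      have h1 : t - 0 ≠ 0 := by linarith
      fun_prop (disch := first | exact h1 | norm_num)) (by norm_num)
  have ht0 : 0 < t := by linarith
  have h2 := (hl1.const_mul x).sub (hl2.const_mul (x' * (t / 2)))
  have hpos : 0 < x * (t / 2) - x' * (t / 2) * 1 := by
    rw [mul_one, sub_pos]; gcongr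
  filter_upwards [h2.eventually_const_lt hpos, eventually_ge_atTop 1] with J h hJ
  have hJ1 : (1 : ℝ) ≤ J := by exact_mod_cast hJ
  have hJ0 : (0 : ℝ) < J := by linarith
  have htJ : 0 < t * J - 1 := by nlinarith
  have e1 : t * (J : ℝ) ^ 2 - J = J * (t * J - 1) := by ring
  have e2 : t - 1 / (J : ℝ) = (t * J - 1) / J := by field_simp
  have hid : x * ((J / (t * (J : ℝ) ^ 2 - J)) / numPoints J) * (t * (J : ℝ) ^ 2 - J) ^ 2
      = J * (x * ((1 / (t - 1 / J)) * (t - 1 / J) ^ 2 / ((2 + 1 / J) * (1 + 1 / J)))) := by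
    rw [numPoints_eq]
    push_cast
    rw [e1, e2]
    field_simp
  have hid2 : x' * t * J / 2 * (1 + ((J : ℝ) / (t * (J : ℝ) ^ 2 - J)) ^ 2)
      = J * (x' * (t / 2) * (1 + (1 / (J : ℝ) / (t - 1 / J)) ^ 2)) := by
    rw [e1, e2]
    field_simp
  rw [hid, hid2]
  exact mul_le_mul_of_nonneg_left (by linarith) hJ0.le

/-- The tangents of the view angles of two points differ by a multiple of their offset. -/
theorem slope_sub_slope {t : ℝ} {J : ℕ} {p q : ℤ × ℤ} (hp : 0 < t * (J : ℝ) ^ 2 + p.1)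
    (hq : 0 < t * (J : ℝ) ^ 2 + q.1) (hp2 : 0 < p.2) :
    (q.2 : ℝ) / (t * (J : ℝ) ^ 2 + q.1) - p.2 / (t * (J : ℝ) ^ 2 + p.1)
      = p.2 * offset t J p q / ((t * (J : ℝ) ^ 2 + p.1) * (t * (J : ℝ) ^ 2 + q.1)) := by
  have hp2' : (0 : ℝ) < p.2 := by exact_mod_cast hp2
  unfold offset
  field_simp
  ring

theorem mem_innerPoints {J : ℕ} {p : ℤ × ℤ} :
    p ∈ innerPoints J ↔ (-(J : ℤ) ≤ p.1 ∧ p.1 ≤ J) ∧ 1 ≤ p.2 ∧ p.2 < J := by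
  simp [innerPoints]

theorem innerPoints_subset (J : ℕ) : innerPoints J ⊆ latticePoints J := fun p hp => by
  rw [mem_innerPoints] at hp
  rw [mem_latticePoints]
  omega

theorem mem_closePoints {t x : ℝ} {J : ℕ} {p : ℤ × ℤ} :
    p ∈ closePoints t J x ↔ p ∈ innerPoints J ∧ HasCloseSuccessor t J x p := by
  simp [closePoints]

/-- View angles compare as offsets do. -/
theorem viewAngle_offset {t : ℝ} {J : ℕ} {p q : ℤ × ℤ} (hJ : 1 ≤ J)
    (htJ : (J : ℝ) < t * (J : ℝ) ^ 2) (hp : p ∈ innerPoints J) (hq : q ∈ latticePoints J) :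
    (viewAngle t J p ≤ viewAngle t J q ↔ 0 ≤ offset t J p q) ∧
    (0 < offset t J p q → viewAngle t J p < viewAngle t J q) ∧
    (viewAngle t J p ≤ viewAngle t J q →
      p.2 * offset t J p q ≤ (1 + (J / (t * (J : ℝ) ^ 2 - J)) ^ 2) *
        (viewAngle t J q - viewAngle t J p) * (t * (J : ℝ) ^ 2 + J) ^ 2) ∧
    (0 ≤ offset t J p q → (viewAngle t J q - viewAngle t J p) * (t * (J : ℝ) ^ 2 - J) ^ 2
      ≤ p.2 * offset t J p q) := by
  have hp' := mem_innerPoints.1 hp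
  have hq' := mem_latticePoints.1 hq
  have hJ0 : (0 : ℝ) < J := by exact_mod_cast hJ
  have p1 : -(J : ℝ) ≤ p.1 := by exact_mod_cast hp'.1.1
  have p1' : (p.1 : ℝ) ≤ J := by exact_mod_cast hp'.1.2
  have q1 : -(J : ℝ) ≤ q.1 := by exact_mod_cast hq'.1.1
  have q1' : (q.1 : ℝ) ≤ J := by exact_mod_cast hq'.1.2
  have q2' : (q.2 : ℝ) ≤ J := by exact_mod_cast hq'.2.2
  have p2 : (0 : ℝ) < p.2 := by exact_mod_cast hp'.2.1
  have hsl := slope_sub_slope (t := t) (J := J) (p := p) (q := q) (by linarith) (by linarith)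
    (by omega)
  rw [viewAngle_eq_arctan (by linarith) (by linarith) (by omega : 0 ≤ p.2),
    viewAngle_eq_arctan (by linarith) (by linarith) hq'.2.1]
  set A := t * (J : ℝ) ^ 2 with hA
  have hPpos : 0 < A + p.1 := by linarith
  have hQpos : 0 < A + q.1 := by linarith
  set u := (p.2 : ℝ) / (A + p.1) with hu
  set v := (q.2 : ℝ) / (A + q.1) with hv
  set D := (A + p.1) * (A + q.1) with hD
  have hDpos : 0 < D := mul_pos hPpos hQpos
  have hmul : (v - u) * D = p.2 * offset t J p q := by rw [hsl]; field_simp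
  have hu0 : 0 ≤ u := by positivity
  have hvT : v ≤ J / (A - J) := div_le_div₀ hJ0.le q2' (by linarith) (by linarith)
  have hDu : D ≤ (A + J) ^ 2 := by
    rw [hD, pow_two]; gcongr; linarith
  have hDl : (A - J) ^ 2 ≤ D := by
    have : 0 ≤ A - J := by linarith
    rw [hD, pow_two]; gcongr <;> linarith
  have hiff : u ≤ v ↔ 0 ≤ offset t J p q := by
    rw [← sub_nonneg, ← mul_nonneg_iff_of_pos_right hDpos, hmul, mul_nonneg_iff_of_pos_left p2]
  refine ⟨?_, ?_, ?_, ?_⟩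
  · rw [Real.arctan_le_arctan_iff, hiff]
  · intro h
    apply Real.arctan_strictMono
    rw [← sub_pos, hsl]; positivity
  · intro h
    rw [Real.arctan_le_arctan_iff] at h
    rw [← hmul]
    have h1 := sub_le_mul_arctan_sub_arctan hu0 h hvT
    have h2 : 0 ≤ v - u := by linarith
    exact mul_le_mul h1 hDu hDpos.le (h2.trans h1)
  · intro h
    have h' := hiff.2 h
    rw [← hmul]
    exact mul_le_mul (arctan_sub_arctan_le h') hDl (sq_nonneg _) (by linarith)

/-- A point followed by no other within `x` times the average angle has no close successor, and
conversely, up to an arbitrarily small change of `x`. -/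
theorem eventually_close_iff {t x x' x'' : ℝ} (ht : 1 < t) (hx : 0 < x) (h' : x' < x)
    (h'' : x < x'') :
    ∀ᶠ J : ℕ in atTop, 0 < averageAngle t J ∧ ∀ p ∈ innerPoints J, ∀ q ∈ latticePoints J,
      (viewAngle t J p ≤ viewAngle t J q →
        viewAngle t J q < viewAngle t J p + x * averageAngle t J →
        0 ≤ offset t J p q ∧ offset t J p q < x'' * t * J / (2 * p.2)) ∧
      (0 < offset t J p q → offset t J p q < x' * t * J / (2 * p.2) →
        viewAngle t J p < viewAngle t J q ∧
        viewAngle t J q < viewAngle t J p + x * averageAngle t J) := by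
  filter_upwards [eventually_average_upper ht h'', eventually_average_lower ht h',
    eventually_ge_atTop 1] with J h1 h2 hJ
  have hJ1 : (1 : ℝ) ≤ J := by exact_mod_cast hJ
  have hJ0 : (0 : ℝ) < J := by linarith
  have htJ : (J : ℝ) < t * (J : ℝ) ^ 2 := by
    nlinarith [mul_pos (sub_pos.2 ht) (pow_pos hJ0 2)]
  have hN : (0 : ℝ) < numPoints J := by rw [numPoints_eq]; positivity
  have hav := averageAngle_eq hJ htJ
  set A := t * (J : ℝ) ^ 2 with hA
  have hAJ : 0 < A - J := by linarith
  set T := (J : ℝ) / (A - J) with hT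
  have hT0 : 0 < T := by positivity
  have hup : averageAngle t J ≤ T / numPoints J := by
    rw [hav]; gcongr
    simpa using arctan_sub_arctan_le hT0.le
  have hlo : T / numPoints J ≤ (1 + T ^ 2) * averageAngle t J := by
    rw [hav, mul_div_assoc']; gcongr
    simpa using sub_le_mul_arctan_sub_arctan le_rfl hT0.le le_rfl
  have hpos : 0 < averageAngle t J := by
    rw [hav]
    have : 0 < Real.arctan T := by rw [← Real.arctan_zero]; exact Real.arctan_strictMono hT0
    positivity
  refine ⟨hpos, fun p hp q hq => ?_⟩
  obtain ⟨k1, k2, k3, k4⟩ := viewAngle_offset hJ htJ hp hq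
  have p2 : (0 : ℝ) < p.2 := by exact_mod_cast (mem_innerPoints.1 hp).2.1
  constructor
  · intro hle hlt
    refine ⟨k1.1 hle, ?_⟩
    rw [lt_div_iff₀ (by positivity)]
    have e1 := k3 hle
    have e2 : (1 + T ^ 2) * (viewAngle t J q - viewAngle t J p) * (A + J) ^ 2
        < (1 + T ^ 2) * (x * (T / numPoints J)) * (A + J) ^ 2 := by
      have : viewAngle t J q - viewAngle t J p < x * (T / numPoints J) := by
        have : x * averageAngle t J ≤ x * (T / numPoints J) := by gcongr
        linarith
      gcongr
    linarith
  · intro hpo hlt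
    refine ⟨k2 hpo, ?_⟩
    rw [lt_div_iff₀ (by positivity)] at hlt
    have e1 := k4 hpo.le
    have e2 : x' * t * J / 2 ≤ x * averageAngle t J * (A - J) ^ 2 := by
      have e3 : x * (T / numPoints J) * (A - J) ^ 2
          ≤ x * averageAngle t J * (A - J) ^ 2 * (1 + T ^ 2) := by
        calc _ ≤ x * ((1 + T ^ 2) * averageAngle t J) * (A - J) ^ 2 := by gcongr
          _ = _ := by ring
      exact le_of_mul_le_mul_right (h2.trans e3) (by positivity)
    have e4 : (viewAngle t J q - viewAngle t J p) * (A - J) ^ 2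
        < x * averageAngle t J * (A - J) ^ 2 := by linarith
    have := lt_of_mul_lt_mul_right e4 (sq_nonneg _)
    linarith

/-! ### Gap counts and their limit. -/

open Classical in
/-- The number of gaps that are at least `x` times the average. -/
noncomputable def gapCount (t : ℝ) (J : ℕ) (x : ℝ) : ℕ :=
  ((Finset.Ico 1 (numPoints J)).filter
      (fun j => x * averageAngle t J ≤ orderedAngle t J (j + 1) - orderedAngle t J j)).card

/-- Gaps are counted through points rather than distinct angles. Points with the same angle could be
overcounted in the upper bound, where the term with `η` pays for them. In the lower bound, points
without a close successor automatically have distinct angles. -/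
theorem eventually_gapCount_bounds {t x x' x'' η : ℝ} (ht : 1 < t) (hη : 0 < η) (hx : 0 < x)
    (h' : x' < x) (h'' : x < x'') :
    ∀ᶠ J : ℕ in atTop,
      gapCount t J x + (closePoints t J x').card ≤ numPoints J + (closePoints t J η).card ∧
      numPoints J ≤ gapCount t J x + (closePoints t J x'').card + (1 + 2 * (2 * J + 1)) := by
  classical
  filter_upwards [eventually_close_iff ht hx h' h'', eventually_ge_atTop 1] with J hJc hJ
  obtain ⟨hav, hcl⟩ := hJc
  have hJ0 : (0 : ℝ) < J := by exact_mod_cast hJ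
  set δ := x * averageAngle t J with hδ
  have hδ0 : 0 < δ := by positivity
  have hgap : gapCount t J x = ((Finset.Ico 1 (numPoints J)).filter
      (fun j => δ ≤ orderedAngle t J (j + 1) - orderedAngle t J j)).card := by
    unfold gapCount; congr!
  set V := (latticePoints J).image (viewAngle t J) with hV
  have hup := card_gaps_le hδ0 (fun i j h1 h2 h3 => orderedAngle_mono (t := t) h1 h2 h3) V
    mem_image_viewAngle_iff
  have hlo := le_card_gaps_add_one (δ := δ) V
    (fun i j h1 h2 h3 => orderedAngle_mono (t := t) h1 h2 h3) mem_image_viewAngle_iff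
  rw [hgap]
  constructor
  · set E := (latticePoints J).filter fun p => ∀ q ∈ latticePoints J,
      viewAngle t J p < viewAngle t J q → viewAngle t J p + δ ≤ viewAngle t J q with hE
    have h1 : (V.filter fun v => ∀ w ∈ V, v < w → v + δ ≤ w).card ≤ E.card := by
      refine le_trans (Finset.card_le_card ?_) (Finset.card_image_le (s := E) (f := viewAngle t J))
      intro v hv
      rw [Finset.mem_filter] at hv
      obtain ⟨p, hp, rfl⟩ := Finset.mem_image.1 hv.1
      refine Finset.mem_image_of_mem _ ?_
      rw [hE, Finset.mem_filter]
      exact ⟨hp, fun q hq => hv.2 _ (Finset.mem_image_of_mem _ hq)⟩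
    have h2 : E ∪ closePoints t J x' ⊆ latticePoints J := by
      refine Finset.union_subset (Finset.filter_subset _ _) fun p hp => ?_
      exact innerPoints_subset J (mem_closePoints.1 hp).1
    have h3 : E ∩ closePoints t J x' ⊆ closePoints t J η := by
      intro p hp
      rw [Finset.mem_inter, mem_closePoints] at hp
      obtain ⟨hpE, hpI, q, hq, hne, h0, hlt⟩ := hp
      rw [mem_closePoints]
      refine ⟨hpI, q, hq, hne, h0, ?_⟩
      have p2 : (0 : ℝ) < p.2 := by exact_mod_cast (mem_innerPoints.1 hpI).2.1
      -- A point of `E` has no strictly larger angle within `δ`, so its close successor has offset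
      -- exactly `0` and is below every positive threshold.
      rcases h0.eq_or_lt with h | h
      · rw [← h]; have : 0 < t := by linarith
        positivity
      · exfalso
        obtain ⟨a1, a2⟩ := (hcl p hpI q hq).2 h hlt
        rw [hE, Finset.mem_filter] at hpE
        exact absurd (hpE.2 q hq a1) (not_le.2 a2)
    have h4 := Finset.card_union_add_card_inter E (closePoints t J x')
    have h5 := Finset.card_le_card h2
    have h6 := Finset.card_le_card h3
    have h7 : (latticePoints J).card = numPoints J := rfl
    omega
  · have hgood : ∀ p ∈ innerPoints J \ closePoints t J x'', ∀ q ∈ latticePoints J, q ≠ p →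
        viewAngle t J p ≤ viewAngle t J q → viewAngle t J p + δ ≤ viewAngle t J q := by
      intro p hp q hq hne hle
      rw [Finset.mem_sdiff, mem_closePoints] at hp
      by_contra hcon
      obtain ⟨a1, a2⟩ := (hcl p hp.1 q hq).1 hle (not_le.1 hcon)
      exact hp.2 ⟨hp.1, q, hq, hne, a1, a2⟩
    have h1 : (innerPoints J \ closePoints t J x'').card
        ≤ (V.filter fun v => ∀ w ∈ V, v < w → v + δ ≤ w).card := by
      refine Finset.card_le_card_of_injOn (viewAngle t J) ?_ ?_
      · intro p hp
        have hp' := Finset.mem_coe.1 hp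
        rw [Finset.mem_coe, Finset.mem_filter]
        refine ⟨Finset.mem_image_of_mem _
          (innerPoints_subset J (Finset.mem_sdiff.1 hp').1), fun w hw hlt => ?_⟩
        obtain ⟨q, hq, rfl⟩ := Finset.mem_image.1 hw
        exact hgood p hp' q hq (fun h => by rw [h] at hlt; exact lt_irrefl _ hlt) hlt.le
      · intro p hp q hq hpq
        by_contra hne
        have := hgood p (Finset.mem_coe.1 hp) q (innerPoints_subset J
          (Finset.mem_sdiff.1 (Finset.mem_coe.1 hq)).1) (Ne.symm hne) hpq.le
        linarith
    -- The rows `0` and `J` account for the `2 (2 J + 1)` points lost, the largest angle for the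
    -- `1`.
    have h2 := Finset.le_card_sdiff (closePoints t J x'') (innerPoints J)
    have h3 := card_innerPoints hJ
    omega

theorem gapDistribution_eq (t : ℝ) (J : ℕ) (x : ℝ) :
    gapDistribution t J x = (gapCount t J x : ℝ) / numPoints J := rfl

theorem tendsto_numPoints_div_sq :
    Tendsto (fun J : ℕ => (numPoints J : ℝ) / (J : ℝ) ^ 2) atTop (𝓝 2) := by
  have h := tendsto_comp_one_div (l := 2) (φ := fun s => (2 + s) * (1 + s)) (by fun_prop)
    (by norm_num)
  refine h.congr' ?_
  filter_upwards [eventually_ge_atTop 1] with J hJ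
  have hJ0 : (0 : ℝ) < J := by exact_mod_cast hJ
  rw [numPoints_eq]
  push_cast
  field_simp

/-- The limit is squeezed by letting `x'` and `x''` tend to `x` and `η` to `0`, using the continuity
of `closeDensity`. -/
theorem tendsto_gapCount {t x : ℝ} (ht : 1 < t) (hx : 0 < x) (hxt : x * t / 2 < 1)
    (hcont : ContinuousAt (closeDensity t) x)
    (hzero : Tendsto (closeDensity t) (𝓝[>] 0) (𝓝 0)) :
    Tendsto (fun J : ℕ => (gapCount t J x : ℝ) / (J : ℝ) ^ 2) atTop
      (𝓝 (2 - closeDensity t x)) := by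
  have ht0 : 0 < t := by linarith
  have hsmall : ∀ᶠ y in 𝓝 x, 0 < y ∧ y * t / 2 < 1 := by
    have h1 : ContinuousAt (fun y : ℝ => y * t / 2) x := by fun_prop
    exact (lt_mem_nhds hx).and (h1.eventually_lt_const hxt)
  have hone : Tendsto (fun J : ℕ => 1 / (J : ℝ)) atTop (𝓝 0) := tendsto_one_div_atTop_nhds_zero_nat
  rw [tendsto_order]
  constructor
  · intro a ha
    have h1 : ∀ᶠ y in 𝓝 x, a < 2 - closeDensity t y :=
      (continuousAt_const.sub hcont).eventually_const_lt ha
    obtain ⟨x'', ⟨h2, h3, h4⟩, hxx⟩ := (((h1.and hsmall).filter_mono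
      nhdsWithin_le_nhds).and (self_mem_nhdsWithin : Set.Ioi x ∈ 𝓝[>] x)).exists
    have hb := eventually_gapCount_bounds ht hx hx (sub_one_lt x) hxx
    have hsq : Tendsto (fun J : ℕ => 3 * (1 / (J : ℝ)) ^ 2 + 4 * (1 / (J : ℝ))) atTop (𝓝 0) := by
      simpa using ((hone.pow 2).const_mul 3).add (hone.const_mul 4)
    have hlim := (tendsto_numPoints_div_sq.sub (tendsto_card_closePoints ht h3 h4)).sub hsq
    rw [sub_zero] at hlim
    filter_upwards [hb, hlim.eventually_const_lt h2, eventually_ge_atTop 1] with J h5 h6 hJ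
    have hJ0 : (0 : ℝ) < J := by exact_mod_cast hJ
    refine h6.trans_le ?_
    have h7 : (numPoints J : ℝ) ≤ gapCount t J x + (closePoints t J x'').card
        + (1 + 2 * (2 * J + 1)) := by exact_mod_cast h5.2
    rw [show (numPoints J : ℝ) / (J : ℝ) ^ 2 - ((closePoints t J x'').card : ℝ) / (J : ℝ) ^ 2
      - (3 * (1 / (J : ℝ)) ^ 2 + 4 * (1 / (J : ℝ)))
      = (numPoints J - (closePoints t J x'').card - (3 + 4 * J)) / (J : ℝ) ^ 2 by field_simp]
    gcongr
    linarith
  · intro a ha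
    obtain ⟨b, hb1, hb2⟩ := exists_between ha
    have h1 : ∀ᶠ y in 𝓝 x, 2 - closeDensity t y < b :=
      (continuousAt_const.sub hcont).eventually_lt_const hb1
    obtain ⟨x', ⟨h2, h3, h4⟩, hxx⟩ := (((h1.and hsmall).filter_mono
      nhdsWithin_le_nhds).and (self_mem_nhdsWithin : Set.Iio x ∈ 𝓝[<] x)).exists
    have h5 : ∀ᶠ y in 𝓝[>] (0 : ℝ), y * t / 2 < 1 := by
      have h1 : ContinuousAt (fun y : ℝ => y * t / 2) 0 := by fun_prop
      exact (h1.eventually_lt_const (by norm_num)).filter_mono nhdsWithin_le_nhds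
    obtain ⟨η, ⟨h6, h7⟩, hη⟩ := (((hzero.eventually_lt_const (sub_pos.2 hb2)).and h5).and
      (self_mem_nhdsWithin : Set.Ioi (0 : ℝ) ∈ 𝓝[>] 0)).exists
    have hb := eventually_gapCount_bounds ht hη hx hxx (lt_add_one x)
    have hlim := (tendsto_numPoints_div_sq.sub (tendsto_card_closePoints ht h3 h4)).add
      (tendsto_card_closePoints ht hη h7)
    filter_upwards [hb, hlim.eventually_lt_const (show _ < a by linarith),
      eventually_ge_atTop 1] with J h8 h9 hJ
    have hJ0 : (0 : ℝ) < J := by exact_mod_cast hJ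
    refine lt_of_le_of_lt ?_ h9
    have h10 : (gapCount t J x : ℝ) + (closePoints t J x').card
        ≤ numPoints J + (closePoints t J η).card := by exact_mod_cast h8.1
    rw [← sub_div, ← add_div]
    gcongr
    linarith

/-! ### The limiting distribution function. -/

theorem continuous_overlapStart (t : ℝ) : Continuous (overlapStart t) := by
  unfold overlapStart; fun_prop

theorem overlapStart_pos {t : ℝ} (ht : 0 < t) (x : ℝ) : 0 < overlapStart t x :=
  lt_min one_pos (lt_max_of_lt_left (by positivity))

theorem continuous_closeDensity {t : ℝ} (ht : 0 < t) : Continuous (closeDensity t) := by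
  have h0 : ∀ x, overlapStart t x ≠ 0 := fun x => (overlapStart_pos ht x).ne'
  have hc := continuous_overlapStart t
  have h1 := hc.log h0
  have h2 : Continuous fun x => 1 / overlapStart t x := continuous_const.div hc h0
  unfold closeDensity
  fun_prop

theorem tendsto_gapDistribution {t x : ℝ} (ht : 1 < t) (hx : 0 < x) (hxt : x < 2 / t) :
    Tendsto (fun J : ℕ => gapDistribution t J x) atTop (𝓝 (1 - closeDensity t x / 2)) := by
  have ht0 : 0 < t := by linarith
  rw [lt_div_iff₀ ht0] at hxt
  have hcont := continuous_closeDensity ht0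
  have hzero : Tendsto (closeDensity t) (𝓝[>] 0) (𝓝 0) := by
    have := hcont.tendsto 0
    rw [show closeDensity t 0 = 0 by simp [closeDensity]] at this
    exact this.mono_left nhdsWithin_le_nhds
  have h := (tendsto_gapCount ht hx (by linarith) hcont.continuousAt hzero).div
    tendsto_numPoints_div_sq two_ne_zero
  rw [show (2 - closeDensity t x) / 2 = 1 - closeDensity t x / 2 by ring] at h
  refine h.congr' ?_
  filter_upwards [eventually_ge_atTop 1] with J hJ
  have hJ0 : (0 : ℝ) < J := by exact_mod_cast hJ
  rw [gapDistribution_eq, Pi.div_apply]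
  have : (0 : ℝ) < numPoints J := by rw [numPoints_eq]; positivity
  field_simp

theorem gapDistribution_nonneg (t : ℝ) (J : ℕ) (x : ℝ) : 0 ≤ gapDistribution t J x := by
  rw [gapDistribution_eq]; positivity

theorem gapDistribution_antitone {t : ℝ} (ht : 1 < t) {x y : ℝ} (hx : 0 < x) (hxy : x ≤ y) :
    ∀ᶠ J : ℕ in atTop, gapDistribution t J y ≤ gapDistribution t J x := by
  classical
  filter_upwards [eventually_close_iff ht hx (sub_one_lt x) (lt_add_one x)] with J hJ
  rw [gapDistribution_eq, gapDistribution_eq]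
  gcongr
  unfold gapCount
  refine Finset.card_le_card fun j hj => ?_
  rw [Finset.mem_filter] at hj ⊢
  refine ⟨hj.1, le_trans ?_ hj.2⟩
  have := hJ.1
  gcongr

theorem gapCount_zero (t : ℝ) (J : ℕ) : gapCount t J 0 = numPoints J - 1 := by
  unfold gapCount
  rw [Finset.filter_true_of_mem, Nat.card_Ico]
  intro j hj
  rw [Finset.mem_Ico] at hj
  have := orderedAngle_mono (t := t) hj.1 (Nat.le_succ j) hj.2
  rw [zero_mul]
  exact sub_nonneg.2 this

theorem tendsto_gapDistribution_zero (t : ℝ) :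
    Tendsto (fun J : ℕ => gapDistribution t J 0) atTop (𝓝 1) := by
  have hN : Tendsto (fun J : ℕ => 1 - 1 / (J : ℝ)) atTop (𝓝 1) := by
    simpa using tendsto_const_nhds.sub (tendsto_one_div_atTop_nhds_zero_nat (𝕜 := ℝ))
  have heq : ∀ J : ℕ, 1 ≤ J → gapDistribution t J 0 = 1 - 1 / (numPoints J : ℝ) := fun J hJ => by
    have h1 : 1 ≤ numPoints J := by rw [numPoints_eq]; exact Nat.mul_pos (by omega) (by omega)
    have h2 : (numPoints J : ℝ) ≠ 0 := by positivity
    rw [gapDistribution_eq, gapCount_zero, Nat.cast_sub h1]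
    field_simp
    simp
  refine tendsto_of_tendsto_of_tendsto_of_le_of_le' hN tendsto_const_nhds ?_ ?_
  · filter_upwards [eventually_ge_atTop 1] with J hJ
    have hJ0 : (0 : ℝ) < J := by exact_mod_cast hJ
    rw [heq J hJ, numPoints_eq]
    have : (J : ℝ) ≤ (((2 * J + 1) * (J + 1) : ℕ) : ℝ) := by
      exact_mod_cast (by nlinarith : J ≤ (2 * J + 1) * (J + 1))
    gcongr
  · filter_upwards [eventually_ge_atTop 1] with J hJ
    rw [heq J hJ]
    have : 0 ≤ 1 / (numPoints J : ℝ) := by positivity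
    linarith

theorem closeDensity_eq_of_two_le {t x : ℝ} (ht : 2 ≤ t) : closeDensity t x = x * t := by
  have : overlapStart t x = 1 := min_eq_left (le_max_of_le_left (by linarith))
  simp [closeDensity, this]

/-- The limiting gap distribution function. -/
noncomputable def limitGap (t x : ℝ) : ℝ := if x < 2 / t then 1 - closeDensity t x / 2 else 0

theorem closeDensity_two_div {t : ℝ} (ht : 0 < t) : closeDensity t (2 / t) = 2 := by
  have h1 : 2 / t * t / 2 = 1 := by field_simp
  have : overlapStart t (2 / t) = 1 := by
    unfold overlapStart
    rw [h1]; exact min_eq_left (le_max_right _ _)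
  simp only [closeDensity, this]
  have h2 : 2 / t * t = 2 := by field_simp
  rw [h2]; simp

theorem isLimitingGapDistribution_limitGap {t : ℝ} (ht : 1 < t) :
    IsLimitingGapDistribution t (limitGap t) := by
  have ht0 : 0 < t := by linarith
  intro x hx
  unfold limitGap
  split_ifs with h
  · rcases hx.eq_or_lt with h0 | h0
    · subst h0
      simpa [closeDensity] using tendsto_gapDistribution_zero t
    · exact tendsto_gapDistribution ht h0 h
  -- Beyond `2 / t` monotonicity in `x` suffices, since the limit just to the left of `2 / t` is
  -- arbitrarily small.
  · rw [not_lt] at h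
    rw [tendsto_order]
    refine ⟨fun a ha => Eventually.of_forall fun J => ha.trans_le (gapDistribution_nonneg t J x),
      fun a ha => ?_⟩
    have hlim : Tendsto (fun y => 1 - closeDensity t y / 2) (𝓝 (2 / t)) (𝓝 0) := by
      have := ((continuous_closeDensity ht0).tendsto (2 / t)).div_const 2 |>.const_sub 1
      rw [closeDensity_two_div ht0] at this
      simpa using this
    have hpos : ∀ᶠ y in 𝓝 (2 / t), 0 < y := lt_mem_nhds (by positivity)
    obtain ⟨y, ⟨h1, h2⟩, h3⟩ := ((((hlim.eventually_lt_const ha).and hpos).filter_mono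
      nhdsWithin_le_nhds).and (self_mem_nhdsWithin : Set.Iio (2 / t) ∈ 𝓝[<] (2 / t))).exists
    have h3' : y < 2 / t := h3
    filter_upwards [gapDistribution_antitone ht h2 (h3'.le.trans h),
      (tendsto_gapDistribution ht h2 h3').eventually_lt_const h1] with J h4 h5
    exact h4.trans_lt h5

theorem limitGap_eq_zero {t x : ℝ} (h : 2 / t ≤ x) : limitGap t x = 0 := if_neg (not_lt.2 h)

theorem limitGap_eq {t x : ℝ} (ht : 0 < t) (h : x ≤ 2 / t) :
    limitGap t x = 1 - closeDensity t x / 2 := by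
  unfold limitGap
  split_ifs with h'
  · rfl
  · rw [le_antisymm h (not_lt.1 h'), closeDensity_two_div ht]; norm_num

end MovingObserver


theorem theorem1 (t : ℝ) :
    (2 < t →
      ∃ G : ℝ → ℝ, MovingObserver.IsLimitingGapDistribution t G ∧
        (∀ x : ℝ, 0 ≤ x → x ≤ 2 / t → G x = 1 - x * t / 2) ∧
        (∀ x : ℝ, 2 / t ≤ x → G x = 0)) ∧
    (1 < t → t ≤ 2 →
      ∃ G : ℝ → ℝ, MovingObserver.IsLimitingGapDistribution t G ∧
        (∀ x : ℝ, 0 ≤ x → x ≤ 1 →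
          G x = 1 + x * t / 2 + x * t * Real.log (t / 2) - x * t ^ 2 / 2) ∧
        (∀ x : ℝ, 1 ≤ x → x ≤ 2 / t →
          G x = 1 - x * t / 2 + x * t * Real.log (x * t / 2) - x * t ^ 2 / 2 + t) ∧
        (∀ x : ℝ, 2 / t ≤ x → G x = 0)) := by
  constructor
  · intro ht
    refine ⟨MovingObserver.limitGap t,
      MovingObserver.isLimitingGapDistribution_limitGap (by linarith), fun x _ hx => ?_,
      fun x hx => MovingObserver.limitGap_eq_zero hx⟩
    rw [MovingObserver.limitGap_eq (by linarith) hx, MovingObserver.closeDensity_eq_of_two_le ht.le]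
  · intro ht ht2
    have ht0 : 0 < t := by linarith
    have h1t : 1 ≤ 2 / t := by rw [le_div_iff₀ ht0]; linarith
    refine ⟨MovingObserver.limitGap t, MovingObserver.isLimitingGapDistribution_limitGap ht,
      fun x hx hx1 => ?_, fun x hx hx1 => ?_, fun x hx => MovingObserver.limitGap_eq_zero hx⟩
    -- For `x ≤ 1` the overlap range starts where neighbouring rows begin to overlap; for `x ≥ 1` it
    -- starts where the same-row neighbour ceases to be close.
    · have hs : MovingObserver.overlapStart t x = t / 2 := by
        unfold MovingObserver.overlapStart
        rw [max_eq_left (by nlinarith), min_eq_right (by linarith)]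
      rw [MovingObserver.limitGap_eq ht0 (hx1.trans h1t), MovingObserver.closeDensity, hs]
      field_simp
      ring
    · have hxt : x * t ≤ 2 := by rwa [le_div_iff₀ ht0] at hx1
      have hx0 : 0 < x := by linarith
      have hs : MovingObserver.overlapStart t x = x * t / 2 := by
        unfold MovingObserver.overlapStart
        rw [max_eq_right (by nlinarith), min_eq_right (by linarith)]
      rw [MovingObserver.limitGap_eq ht0 hx1, MovingObserver.closeDensity, hs]
      field_simp
      ring
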